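/- **Proposition (segment count).** All graphs are finite and simple. A *good cubic graph* is a $3$-regular graph $H$ on $14$ vertices, not necessarily connected, in which any two distinct non-adjacent vertices have at most one common neighbour. Let $yz$ be an edge of a good cubic graph $H$, taken with its ordering $(y,z)$, that lies in no triangle of $H$. Let $y_1,y_2$ be the two neighbours of $y$ other than $z$, and let $z_1,z_2$ be the two neighbours of $z$ other than $y$. The *segment* obtained from $H$ and $(y,z)$ is the triple consisting of the subgraph $S$ of $H$ induced on the $12$ vertices other than $y$ and $z$, the first *handle* $\{y_1,y_2\}$ and the second *handle* $\{z_1,z_2\}$. An isomorphism of segments is a graph isomorphism that maps the first handle onto the first handle and the second handle onto the second handle. A handle is called an *edge* if its two vertices are adjacent and a *non-edge* otherwise; a segment is of type (1), (2), (3) or (4) if its first and second handles are, respectively, edge and edge, edge and non-edge, non-edge and edge, non-edge and non-edge. Then there are, up to isomorphism, exactly $478$ segments. Every segment is of exactly one of the four types, and up to isomorphism there are exactly $19$, $78$, $78$ and $303$ segments of types (1), (2), (3) and (4), respectively. -/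

import Mathlib

/-- A good cubic graph: a cubic graph (connected or not) on `14` vertices in which any two distinct
non-adjacent vertices have at most one common neighbour. -/
structure IsGoodCubic {W : Type} (H : SimpleGraph W) : Prop where
  order : Nat.card W = 14
  cubic : ∀ v : W, (H.neighborSet v).ncard = 3
  common : ∀ u v : W, u ≠ v → ¬ H.Adj u v → (H.commonNeighbors u v).ncard ≤ 1

/-- A graph together with an ordered pair of vertex subsets, its first and second handle. -/
structure HandledGraph where
  V : Type
  graph : SimpleGraph V
  first : Set V
  second : Set V

namespace HandledGraph

/-- Isomorphism: a graph isomorphism mapping the first handle onto the first handle and the second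
handle onto the second handle. -/
def Iso (S T : HandledGraph) : Prop :=
  ∃ e : S.graph ≃g T.graph, e '' S.first = T.first ∧ e '' S.second = T.second

theorem Iso.refl (S : HandledGraph) : S.Iso S :=
  ⟨SimpleGraph.Iso.refl, by ext; simp, by ext; simp⟩

theorem Iso.symm {S T : HandledGraph} (h : S.Iso T) : T.Iso S := by
  obtain ⟨e, h₁, h₂⟩ := h
  refine ⟨e.symm, ?_, ?_⟩
  · rw [← h₁, ← Set.image_comp]; ext; simp
  · rw [← h₂, ← Set.image_comp]; ext; simp

theorem Iso.trans {S T U : HandledGraph} (h : S.Iso T) (k : T.Iso U) : S.Iso U := by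
  obtain ⟨e, h₁, h₂⟩ := h
  obtain ⟨f, k₁, k₂⟩ := k
  refine ⟨e.trans f, ?_, ?_⟩
  · rw [← k₁, ← h₁, ← Set.image_comp]; rfl
  · rw [← k₂, ← h₂, ← Set.image_comp]; rfl

/-- Delete two vertices `y` and `z` from a graph `H`, with their incident edges. The handles are the
sets of remaining neighbours of `y` and of `z`. -/
def ofEdge {W : Type} (H : SimpleGraph W) (y z : W) : HandledGraph where
  V := {w : W // w ≠ y ∧ w ≠ z}
  graph := H.comap Subtype.val
  first := {w | H.Adj y w}
  second := {w | H.Adj z w}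

/-- A segment: a good cubic graph `H` minus the two ends of an edge `yz` of `H` that lies in no
triangle, with its two handles (up to renaming the vertices). -/
def IsSegment (S : HandledGraph) : Prop :=
  ∃ (W : Type) (H : SimpleGraph W) (y z : W), IsGoodCubic H ∧ H.Adj y z ∧
    (∀ w : W, ¬ (H.Adj y w ∧ H.Adj z w)) ∧ S.Iso (ofEdge H y z)

/-- The number of isomorphism classes of handled graphs with the property `P`. -/
noncomputable def isoClassCount (P : HandledGraph → Prop) : ℕ :=
  Nat.card (Quotient (α := {S : HandledGraph // P S})
    { r := fun S T => S.1.Iso T.1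
      iseqv := ⟨fun S => Iso.refl S.1, Iso.symm, Iso.trans⟩ })

end HandledGraph

/-- The two kinds of handle. -/
inductive HandleKind where
  | edge
  | nonEdge

/-- A handle, which is a pair of distinct vertices, is an edge if the two vertices are adjacent and
a non-edge if they are not. -/
def HandleKind.Holds {V : Type} (G : SimpleGraph V) (Y : Set V) : HandleKind → Prop
  | .edge => ∃ a b : V, a ≠ b ∧ Y = {a, b} ∧ G.Adj a b
  | .nonEdge => ∃ a b : V, a ≠ b ∧ Y = {a, b} ∧ ¬ G.Adj a b

/-- The first handle is of kind `t.1` and the second one is of kind `t.2`. -/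
def HandledGraph.HasType (S : HandledGraph) (t : HandleKind × HandleKind) : Prop :=
  t.1.Holds S.graph S.first ∧ t.2.Holds S.graph S.second

/-! A segment with its ordered handles determines $H$ and $(y,z)$: restore two adjacent vertices,
one joined to the first handle and one to the second. Counting segments up to isomorphism is
therefore counting good cubic graphs with an ordered edge in no triangle, up to isomorphisms that
respect both ends. Label such a graph by `0, …, 13` with `y = 0` and `z = 1`, and read the adjacency
matrix above the diagonal column by column. These columns determine the graph, so each class
contains exactly one labelled graph whose sequence of columns is lexicographically maximal under
renaming `2, …, 13` (`exists_maximal`, `eq_of_iso`).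

The maximal graphs are found by orderly generation, one vertex at a time. Two facts justify the
pruning: every initial part of a maximal graph passes the maximality test (`Maximal.isMax`), and a
new vertex is adjacent to the first vertex of degree below `3`, if there is one (`adj_first`). Hence
no maximal graph is lost (`mem_explore_of_maximal`). Conversely, everything found is genuine,
because each finished graph is tested in full (`exists_of_mem_explore`, `accept_iff`). Together this
is `mem_canonicalList`.

Since `01` lies in no triangle, a handle is an edge exactly when its end of `01` lies in a triangle,
so the type can be read off the matrix (`hasType_seg`). The search is evaluated once, in
`tally_canonicalList`; this yields 19, 78, 78 and 303, with sum 478. Much of the remaining work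
shows that arithmetic on packed numbers treats all fields in parallel as intended (`check_cons`,
`itemSum_eq`). -/

namespace SegmentCount

/-! ### The enumeration

The functions of this section are evaluated by the kernel, so they are written with explicit
recursors and with the binary operations on `ℕ` that the kernel accelerates. A graph on the vertices
`0, …, n - 1` is a single number, in which row `i` of the adjacency matrix occupies the bits from
`256 * i` on, and entry `j` of a row the bits from `16 * j` on. -/

/-- `forceShift f y = f (y >>> 64)`, evaluated with `y` reduced to a literal. -/
noncomputable def forceShift {α : Type} (f : ℕ → α) (y : ℕ) : α :=
  Nat.rec (f 0) (fun n _ => f (Nat.shiftRight (Nat.succ n) 64)) y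

/-- `force x f = f x`, evaluated with `x` reduced to a literal, to which low bits are appended
because they serve as its hash value. -/
noncomputable def force {α : Type} (x : ℕ) (f : ℕ → α) : α :=
  forceShift f (Nat.add (Nat.mul x 18446744073709551616) (Nat.mod x 2305843009213693951))

/-- Lazy selection. -/
noncomputable def sel {α : Type} (b : Bool) (x y : α) : α := Bool.rec y x b

/-- Does `P e` hold for every set bit `e` of `E`? -/
noncomputable def allBits (P : ℕ → Bool) (fuel : ℕ) : ℕ → Bool :=
  Nat.rec (fun _ => true)
    (fun _ ih E => sel (Nat.beq E 0) true
      (force (Nat.log2 E) fun e => sel (P e) (ih (Nat.sub E (Nat.pow 2 e))) false)) fuel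

/-- Row `e / 16` of the matrix `A`. -/
noncomputable def row (A e : ℕ) : ℕ :=
  Nat.mod (Nat.shiftRight A (Nat.mul 16 e)) (Nat.pow 2 256)

/-- The number with entries `1` at the places `0, …, n - 1`. -/
noncomputable def ones (n : ℕ) : ℕ := Nat.div (Nat.pow 2 (Nat.mul 16 n)) 65535

/-- Does no continuation of a partial relabelling yield lexicographically larger columns than `cs`?
The entries of `S` are the columns that the vertices would have if they were chosen next, and `U`
marks the vertices chosen so far. -/
noncomputable def check (A O H : ℕ) (cs : List ℕ) : ℕ → ℕ → Bool :=
  List.rec (fun _ _ => true)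
    (fun c _ ih S U =>
      force (Nat.sub (Nat.add (Nat.mul O (Nat.add 32768 c)) (Nat.mul U 16384)) S) fun T =>
        sel (Nat.beq (Nat.land T H) H)
          (force (Nat.shiftRight (Nat.sub H (Nat.land (Nat.sub T O) H)) 15)
            (allBits (fun e => force (Nat.add (Nat.mul 2 S) (row A e)) fun S' =>
              ih S' (Nat.add U (Nat.pow 2 e))) 14))
          false)
    cs

/-- The list of the next `n` columns of `A`, passed to a continuation. -/
noncomputable def columns {α : Type} (A n : ℕ) : ℕ → ℕ → (List ℕ → α) → α :=
  Nat.rec (fun _ _ f => f [])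
    (fun _ ih S e f => force (Nat.mod (Nat.shiftRight S e) 65536) fun c =>
      ih (Nat.add (Nat.mul 2 S) (row A e)) (Nat.add e 16) fun cs => f (c :: cs)) n

/-- Is the graph `A` on `n` vertices lexicographically maximal? -/
noncomputable def isMax (n A : ℕ) : Bool :=
  force (Nat.add (Nat.mul 2 (row A 0)) (row A 16)) fun S =>
    force (ones n) fun O =>
      columns A (Nat.sub n 2) S 32 fun cs => check A O (Nat.mul O 32768) cs S 65537

/-- The contribution of the neighbour `e / 16` of a new vertex: its mark, its row and its mark in
the format of a matrix column. -/
noncomputable def item (A e : ℕ) : ℕ :=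
  Nat.add (Nat.pow 2 e) (Nat.add (Nat.mul (row A e) (Nat.pow 2 256))
    (Nat.pow 2 (Nat.add (Nat.mul 16 e) 512)))

/-- The list of the items of the set bits of `E`, passed to a continuation. -/
noncomputable def collect {α : Type} (A : ℕ) (f : List ℕ → α) (fuel : ℕ) : ℕ → List ℕ → α :=
  Nat.rec (fun _ l => f l)
    (fun _ ih E l => sel (Nat.beq E 0) (f l)
      (force (Nat.log2 E) fun e => force (item A e) fun t =>
        ih (Nat.sub E (Nat.pow 2 e)) (t :: l))) fuel

/-- The marks of the vertices of degree less than `3`. -/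
noncomputable def unsaturated (O D : ℕ) : ℕ :=
  Nat.shiftRight (Nat.sub (Nat.mul O 4) (Nat.land (Nat.add D O) (Nat.mul O 4))) 2

/-- The sums of `t` and at most `m` members of a list. -/
noncomputable def subsums (m : ℕ) : List ℕ → ℕ → List ℕ → List ℕ :=
  Nat.rec (fun _ t acc => t :: acc)
    (fun _ ihm U => List.rec (fun t acc => t :: acc)
      (fun q U ihU t acc => ihm U (Nat.add t q) (ihU t acc)) U) m

/-- The possible neighbourhoods of a new vertex. -/
noncomputable def candidates (U : List ℕ) : List ℕ :=
  List.rec [0] (fun p U _ => subsums 2 U p []) U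

/-- Is a new vertex with the marks `b` compatible with the conditions on common neighbours? -/
noncomputable def admissible (O t b : ℕ) : Bool :=
  sel (Nat.beq (Nat.mod b (Nat.pow 2 32)) 65537) false
    (Nat.beq (Nat.lor (Nat.land (Nat.mod (Nat.shiftRight t 256) (Nat.pow 2 256)) (Nat.mul O 2))
      (Nat.mul 2 b)) (Nat.mul 2 b))

/-- Can all degrees reach `3` when `r` vertices are still to come? -/
noncomputable def minDeg (O D r : ℕ) : Bool :=
  Nat.beq (Nat.land (Nat.add D (Nat.mul O (Nat.succ r))) (Nat.mul O 4)) (Nat.mul O 4)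

/-- Does `P i` hold for all `i < n`? -/
noncomputable def allBelow (P : ℕ → Bool) (n : ℕ) : Bool :=
  Nat.rec true (fun i ih => sel (P i) ih false) n

/-- Is every vertex `j < i` adjacent to `i`, or has it at most one common neighbour with `i`? -/
noncomputable def pairTest (A i : ℕ) : Bool :=
  force (row A (Nat.mul 16 i)) fun M => allBelow (fun j =>
    sel (Nat.beq (Nat.mod (Nat.shiftRight M (Nat.mul 16 j)) 65536) 1) true
      (Nat.ble (Nat.mod (Nat.land M (row A (Nat.mul 16 j))) 65535) 1)) i

/-- The conditions on common neighbours for a graph on `14` vertices. -/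
noncomputable def commonTest (A : ℕ) : Bool :=
  sel (Nat.beq (Nat.mod (Nat.land (row A 0) (row A 16)) 65535) 0)
    (allBelow (pairTest A) 14) false

/-- The final test for a graph `A` with degrees `D`. -/
noncomputable def accept (A D : ℕ) : Bool :=
  sel (Nat.beq D (Nat.mul 3 (ones 14))) (sel (isMax 14 A) (commonTest A) false) false

/-- The degrees after adding a vertex `k` with the marks `b`. -/
noncomputable def addDeg (k D b : ℕ) : ℕ :=
  Nat.add D (Nat.add b (Nat.mul (Nat.mod b 65535) (Nat.pow 2 (Nat.mul 16 k))))

/-- The graph after adding a vertex `k` with the marks `b` and the sum of items `t`. -/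
noncomputable def addRow (k A b t : ℕ) : ℕ :=
  Nat.add A (Nat.add (Nat.mul b (Nat.pow 2 (Nat.mul 256 k)))
    (Nat.mul (Nat.shiftRight t 512) (Nat.pow 2 (Nat.mul 16 k))))

/-- All ways to complete a graph `A` with degrees `D` by `r` further vertices. -/
noncomputable def explore (r : ℕ) : ℕ → ℕ → List ℕ → List ℕ :=
  Nat.rec (fun A D acc => sel (accept A D) (A :: acc) acc)
    (fun r ih A D acc =>
      force (ones (Nat.sub 13 r)) fun O =>
        collect A (fun U => List.rec acc (fun t _ rest =>
          force (Nat.mod t (Nat.pow 2 256)) fun b =>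
            sel (admissible O t b)
              (force (addDeg (Nat.sub 13 r) D b) fun D' =>
                -- With at least `3` vertices to come, every degree can still reach `3`, so this
                -- test matters only near the end; there the maximality test is postponed to
                -- `accept`.
                sel (sel (Nat.ble 3 r) true (minDeg (ones (Nat.sub 14 r)) D' r))
                  (force (addRow (Nat.sub 13 r) A b t) fun A' =>
                    sel (sel (Nat.ble 3 r) (isMax (Nat.sub 14 r) A') true) (ih A' D' rest) rest)
                  rest)
              rest)
          (candidates U)) 14 (unsaturated O D) []) r

/-- All lexicographically maximal graphs. -/
noncomputable def canonicalList : List ℕ :=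
  -- The start is the single edge `01`: its matrix, and the degrees `1, 1`.
  explore 12 (Nat.add (Nat.pow 2 256) (Nat.pow 2 16)) 65537 []

/-- Is there no triangle at the vertex `e / 16`? -/
noncomputable def noTriangle (A e : ℕ) : Bool :=
  force (row A e) fun R => allBits (fun f => Nat.beq (Nat.land (row A f) R) 0) 14 R

/-- The number formed by the columns of `A`. -/
noncomputable def key (A : ℕ) : ℕ :=
  columns A 12 (Nat.add (Nat.mul 2 (row A 0)) (row A 16)) 32
    (List.rec (fun x => x) (fun c _ ih x => ih (Nat.add (Nat.mul x 65536) c)) · 0)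

/-- Are the keys in a list decreasing, from `x` on, and are there `n₁`, `n₂`, `n₃` and `n₄` members
with a triangle at both, only the first, only the second and neither of the first two vertices,
after adding `a`, `b`, `c` and `d`? -/
noncomputable def tally (n₁ n₂ n₃ n₄ : ℕ) (l : List ℕ) : ℕ → ℕ → ℕ → ℕ → ℕ → Bool :=
  List.rec
    (fun _ a b c d => sel (Nat.beq a n₁) (sel (Nat.beq b n₂) (sel (Nat.beq c n₃)
      (Nat.beq d n₄) false) false) false)
    (fun A _ ih x a b c d => force (key A) fun y => sel (Nat.ble x y) false
      (sel (noTriangle A 0)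
        (sel (noTriangle A 16) (ih y a b c (Nat.succ d)) (ih y a b (Nat.succ c) d))
        (sel (noTriangle A 16) (ih y a (Nat.succ b) c d) (ih y (Nat.succ a) b c d)))) l

/-- This is the only large computation. A key consists of `12` columns of `16` bits, hence lies
below `2 ^ 200`; the decreasing keys serve to exclude repetitions. -/
theorem tally_canonicalList :
    tally 19 78 78 303 canonicalList (2 ^ 200) 0 0 0 0 = true := by
  decide +kernel

/-! ### Packed sequences -/

/-- The number with the entries `f 0, …, f (n - 1)` in fields of `w` bits. -/
def pack (w n : ℕ) (f : ℕ → ℕ) : ℕ := ∑ v ∈ Finset.range n, f v * 2 ^ (w * v)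

variable {w n k : ℕ} {f g : ℕ → ℕ}

@[simp] theorem pack_zero : pack w 0 f = 0 := by simp [pack]

theorem pack_succ : pack w (n + 1) f = pack w n f + f n * 2 ^ (w * n) := by
  simp [pack, Finset.sum_range_succ]

theorem pack_congr (h : ∀ v < n, f v = g v) : pack w n f = pack w n g :=
  Finset.sum_congr rfl fun v hv => by rw [h v (Finset.mem_range.1 hv)]

theorem pack_add : pack w n f + pack w n g = pack w n fun v => f v + g v := by
  simp [pack, ← Finset.sum_add_distrib, add_mul]

theorem mul_pack (c : ℕ) : c * pack w n f = pack w n fun v => c * f v := by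
  simp [pack, Finset.mul_sum, mul_assoc]

theorem pack_mul (c : ℕ) : pack w n f * c = pack w n fun v => f v * c := by
  simp [pack, Finset.sum_mul, mul_right_comm]

theorem pack_eq_zero : pack w n f = 0 ↔ ∀ v < n, f v = 0 := by
  simp [pack, Finset.sum_eq_zero_iff]

theorem pack_sub (h : ∀ v < n, g v ≤ f v) :
    pack w n f - pack w n g = pack w n fun v => f v - g v := by
  refine Nat.sub_eq_of_eq_add ?_
  rw [pack_add]
  exact pack_congr fun v hv => (Nat.sub_add_cancel (h v hv)).symm

theorem pack_lt (h : ∀ v < n, f v < 2 ^ w) : pack w n f < 2 ^ (w * n) := by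
  induction n with
  | zero => simp
  | succ n ih =>
    have h₁ := ih fun v hv => h v (by omega)
    have h₂ : (f n + 1) * 2 ^ (w * n) ≤ 2 ^ w * 2 ^ (w * n) :=
      Nat.mul_le_mul_right _ (h n (by omega))
    rw [pack_succ, mul_add, mul_one, pow_add, mul_comm (2 ^ (w * n))]
    linarith

theorem testBit_pack (h : ∀ v < n, f v < 2 ^ w) {i : ℕ} (hi : i < w) (v : ℕ) :
    (pack w n f).testBit (w * v + i) = (decide (v < n) && (f v).testBit i) := by
  induction n with
  | zero => simp
  | succ n ih =>
    have hlt := pack_lt fun v (hv : v < n) => h v (by omega)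
    rw [pack_succ, add_comm, mul_comm, Nat.testBit_two_pow_mul_add _ hlt]
    rcases lt_trichotomy v n with hv | rfl | hv
    · have : w * v + i < w * n := by nlinarith
      rw [if_pos this, ih fun v hv => h v (by omega)]
      simp [hv, hv.trans (Nat.lt_succ_self n)]
    · simp
    · have h₁ : w * n + w ≤ w * v := by nlinarith
      rw [if_neg (by omega), Nat.testBit_lt_two_pow, eq_comm]
      · simp; omega
      · exact (h n (by omega)).trans_le (Nat.pow_le_pow_right (by norm_num) (by omega))

theorem pack_shiftRight_mod (h : ∀ v < n, f v < 2 ^ w) (hk : k < n) :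
    (pack w n f >>> (w * k)) % 2 ^ w = f k := by
  refine Nat.eq_of_testBit_eq fun i => ?_
  rw [Nat.testBit_mod_two_pow, Nat.testBit_shiftRight]
  by_cases hi : i < w
  · simp [hi, testBit_pack h hi, hk]
  · simp only [hi, decide_false, Bool.false_and]
    rw [Nat.testBit_lt_two_pow]
    exact (h k hk).trans_le (Nat.pow_le_pow_right (by norm_num) (by omega))

theorem pack_inj (hf : ∀ v < n, f v < 2 ^ w) (hg : ∀ v < n, g v < 2 ^ w) :
    pack w n f = pack w n g ↔ ∀ v < n, f v = g v := by
  refine ⟨fun h v hv => ?_, pack_congr⟩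
  rw [← pack_shiftRight_mod hf hv, h, pack_shiftRight_mod hg hv]

theorem eq_of_testBit_field (hw : 0 < w) {x y : ℕ}
    (h : ∀ v i, i < w → x.testBit (w * v + i) = y.testBit (w * v + i)) : x = y := by
  refine Nat.eq_of_testBit_eq fun i => ?_
  rw [← Nat.div_add_mod i w]
  exact h _ _ (Nat.mod_lt _ hw)

theorem pack_land (hw : 0 < w) (hf : ∀ v < n, f v < 2 ^ w) (hg : ∀ v < n, g v < 2 ^ w) :
    pack w n f &&& pack w n g = pack w n fun v => f v &&& g v := by
  refine eq_of_testBit_field hw fun v i hi => ?_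
  rw [Nat.testBit_and, testBit_pack hf hi, testBit_pack hg hi,
    testBit_pack (fun v hv => Nat.and_lt_two_pow _ (hg v hv)) hi, Nat.testBit_and]
  cases decide (v < n) <;> simp

theorem pack_lor (hw : 0 < w) (hf : ∀ v < n, f v < 2 ^ w) (hg : ∀ v < n, g v < 2 ^ w) :
    pack w n f ||| pack w n g = pack w n fun v => f v ||| g v := by
  refine eq_of_testBit_field hw fun v i hi => ?_
  rw [Nat.testBit_or, testBit_pack hf hi, testBit_pack hg hi,
    testBit_pack (fun v hv => Nat.or_lt_two_pow (hf v hv) (hg v hv)) hi, Nat.testBit_or]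
  cases decide (v < n) <;> simp

/-- Because `2 ^ 16` is `1` modulo `65535`, reduction gives the digit sum. This is how degrees and
common neighbours are counted. -/
theorem pack_mod : pack 16 n f % 65535 = (∑ v ∈ Finset.range n, f v) % 65535 := by
  have h : pack 16 n f ≡ ∑ v ∈ Finset.range n, f v [MOD 65535] := by
    induction n with
    | zero => simp [Nat.ModEq]
    | succ n ih =>
      rw [pack_succ, Finset.sum_range_succ]
      refine ih.add ?_
      have h₁ : 2 ^ (16 * n) ≡ 1 ^ n [MOD 65535] := by
        rw [pow_mul]
        exact Nat.ModEq.pow _ (by decide)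
      simpa using h₁.mul_left (f n)
  exact h

/-! ### The operations of the enumeration on packed sequences -/

theorem mul_add_mod_shiftRight {x p i : ℕ} (hp : 0 < p) (hpi : p ≤ 2 ^ i) :
    (x * 2 ^ i + x % p) >>> i = x := by
  have h := (Nat.mod_lt x hp).trans_le hpi
  rw [Nat.shiftRight_eq_div_pow, mul_comm, Nat.mul_add_div (by positivity), Nat.div_eq_of_lt h,
    add_zero]

theorem nat_add_eq (a b : ℕ) : Nat.add a b = a + b := rfl
theorem nat_sub_eq (a b : ℕ) : Nat.sub a b = a - b := rfl
theorem nat_mul_eq (a b : ℕ) : Nat.mul a b = a * b := rfl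
theorem nat_mod_eq (a b : ℕ) : Nat.mod a b = a % b := rfl
theorem nat_land_eq (a b : ℕ) : Nat.land a b = a &&& b := rfl

theorem forceShift_eq {α : Type} (f : ℕ → α) (y : ℕ) : forceShift f y = f (y >>> 64) := by
  cases y with
  | zero => rw [Nat.zero_shiftRight]; rfl
  | succ y => rfl

theorem mul_add_mod_shiftRight_64 {x p M : ℕ} (hM : M = 2 ^ 64) (hp : 0 < p) (hpM : p ≤ M) :
    Nat.add (Nat.mul x M) (Nat.mod x p) >>> 64 = x := by
  subst hM
  exact mul_add_mod_shiftRight hp hpM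

theorem force_eq {α : Type} (x : ℕ) (f : ℕ → α) : force x f = f x := by
  unfold force
  rw [forceShift_eq, mul_add_mod_shiftRight_64 (by norm_num) (by norm_num) (by norm_num)]

@[simp] theorem sel_true {α : Type} (x y : α) : sel true x y = x := rfl

@[simp] theorem sel_false {α : Type} (x y : α) : sel false x y = y := rfl

@[simp] theorem sel_eq_true (b x y : Bool) :
    sel b x y = true ↔ (b = true ∧ x = true) ∨ (b = false ∧ y = true) := by
  cases b <;> simp [sel]

theorem nat_beq_eq_true (a b : ℕ) : Nat.beq a b = true ↔ a = b :=
  ⟨Nat.eq_of_beq_eq_true, fun h => h ▸ Nat.beq_refl a⟩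

theorem nat_beq_eq_false (a b : ℕ) : Nat.beq a b = false ↔ a ≠ b := by
  rw [← Bool.not_eq_true, nat_beq_eq_true]

theorem nat_ble_eq_true (a b : ℕ) : Nat.ble a b = true ↔ a ≤ b := by
  rw [Nat.ble_eq]

theorem nat_ble_eq_false (a b : ℕ) : Nat.ble a b = false ↔ b < a := by
  rw [← Bool.not_eq_true, nat_ble_eq_true, not_le]

/-- A geometric series: the division leaves remainder `1`, which rounding down removes. -/
theorem ones_eq : ones n = pack 16 n fun _ => 1 := by
  have h : pack 16 n (fun _ => 1) * 65535 + 1 = 2 ^ (16 * n) := by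
    induction n with
    | zero => simp
    | succ n ih => rw [pack_succ, add_mul, add_right_comm, ih, mul_add, pow_add]; ring
  change 2 ^ (16 * n) / 65535 = _
  omega

/-! ### Iteration over the set bits of a packed sequence. -/

theorem log2_add_two_pow {x e : ℕ} (h : x < 2 ^ e) : Nat.log2 (x + 2 ^ e) = e := by
  rw [Nat.log2_eq_iff (by positivity), pow_succ]
  omega

/-- Peeling off the highest set bit. -/
theorem pack_bits_succ (hf : ∀ v < n + 1, f v = 0 ∨ f v = 1) :
    (f n = 0 ∧ pack 16 (n + 1) f = pack 16 n f) ∨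
    (f n = 1 ∧ pack 16 (n + 1) f ≠ 0 ∧ Nat.log2 (pack 16 (n + 1) f) = 16 * n ∧
      pack 16 (n + 1) f - 2 ^ (16 * n) = pack 16 n f) := by
  have hlt : pack 16 n f < 2 ^ (16 * n) :=
    pack_lt fun v hv => by rcases hf v (by omega) with h | h <;> simp [h]
  rw [pack_succ]
  rcases hf n (by omega) with h | h
  · simp [h]
  · refine .inr ⟨h, ?_, ?_, ?_⟩
    · simp [h]
    · rw [h, one_mul, log2_add_two_pow hlt]
    · simp [h]

theorem allBits_pack {P : ℕ → Bool} {fuel : ℕ} (hn : n ≤ fuel)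
    (hf : ∀ v < n, f v = 0 ∨ f v = 1) :
    allBits P fuel (pack 16 n f) = true ↔ ∀ v < n, f v = 1 → P (16 * v) = true := by
  induction n generalizing fuel with
  | zero => cases fuel <;> simp [allBits, sel]
  | succ n ih =>
    have hf' : ∀ v < n, f v = 0 ∨ f v = 1 := fun v hv => hf v (by omega)
    rcases pack_bits_succ hf with ⟨h, h₁⟩ | ⟨h, h₁, h₂, h₃⟩
    · rw [h₁, ih (by omega) hf', Nat.forall_lt_succ_right]
      simp [h]
    · obtain ⟨m, rfl⟩ : ∃ m, fuel = m + 1 := ⟨fuel - 1, by omega⟩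
      have hrec : allBits P (m + 1) (pack 16 (n + 1) f) =
          sel (P (16 * n)) (allBits P m (pack 16 n f)) false := by
        change sel (Nat.beq (pack 16 (n + 1) f) 0) true (force (Nat.log2 (pack 16 (n + 1) f))
          fun e => sel (P e) (allBits P m (pack 16 (n + 1) f - 2 ^ e)) false) = _
        rw [force_eq, h₂, h₃, (nat_beq_eq_false _ _).2 h₁]
        rfl
      rw [hrec, Nat.forall_lt_succ_right, sel_eq_true, ih (by omega) hf']
      simp [h, and_comm]

theorem collect_pack {α : Type} {A : ℕ} {F : List ℕ → α} {fuel : ℕ} (hn : n ≤ fuel)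
    (hf : ∀ v < n, f v = 0 ∨ f v = 1) (l : List ℕ) :
    collect A F fuel (pack 16 n f) l =
      F (((List.range n).filter fun v => f v = 1).map (fun v => item A (16 * v)) ++ l) := by
  induction n generalizing fuel l with
  | zero => cases fuel <;> simp [collect, sel]
  | succ n ih =>
    have hf' : ∀ v < n, f v = 0 ∨ f v = 1 := fun v hv => hf v (by omega)
    rw [List.range_succ, List.filter_append, List.map_append]
    rcases pack_bits_succ hf with ⟨h, h₁⟩ | ⟨h, h₁, h₂, h₃⟩
    · rw [h₁, ih (by omega) hf']
      simp [h]
    · obtain ⟨m, rfl⟩ : ∃ m, fuel = m + 1 := ⟨fuel - 1, by omega⟩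
      have hrec : collect A F (m + 1) (pack 16 (n + 1) f) l =
          collect A F m (pack 16 n f) (item A (16 * n) :: l) := by
        change sel (Nat.beq (pack 16 (n + 1) f) 0) (F l) (force (Nat.log2 (pack 16 (n + 1) f))
          fun e => force (item A e) fun t =>
            collect A F m (pack 16 (n + 1) f - 2 ^ e) (t :: l)) = _
        rw [force_eq, force_eq, h₂, h₃, (nat_beq_eq_false _ _).2 h₁]
        rfl
      rw [hrec, ih (by omega) hf']
      simp [h]

theorem mem_subsums (m : ℕ) (U : List ℕ) (t : ℕ) (acc : List ℕ) (x : ℕ) :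
    x ∈ subsums m U t acc ↔
      x ∈ acc ∨ ∃ L : List ℕ, L.Sublist U ∧ L.length ≤ m ∧ x = t + L.sum := by
  induction m generalizing U t acc with
  | zero =>
    change x ∈ t :: acc ↔ _
    simp only [List.mem_cons, nonpos_iff_eq_zero, List.length_eq_zero_iff]
    constructor
    · rintro (h | h)
      · exact .inr ⟨[], by simp [h]⟩
      · exact .inl h
    · rintro (h | ⟨L, -, rfl, h⟩)
      · exact .inr h
      · exact .inl (by simpa using h)
  | succ m ihm =>
    induction U generalizing t acc with
    | nil =>
      change x ∈ t :: acc ↔ _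
      simp [or_comm]
    | cons q U ihU =>
      change x ∈ subsums m U (t + q) (subsums (m + 1) U t acc) ↔ _
      rw [ihm, ihU, or_assoc]
      refine or_congr_right ?_
      constructor
      · rintro (⟨L, h₁, h₂, h₃⟩ | ⟨L, h₁, h₂, h₃⟩)
        · exact ⟨L, h₁.cons _, h₂, h₃⟩
        · exact ⟨q :: L, h₁.cons_cons _, by simpa using h₂, by simp [h₃, add_assoc]⟩
      · rintro ⟨L, h₁, h₂, h₃⟩
        rcases List.sublist_cons_iff.1 h₁ with h | ⟨r, rfl, h⟩
        · exact .inl ⟨L, h, h₂, h₃⟩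
        · exact .inr ⟨r, h, by simpa using h₂, by simp [h₃, add_assoc]⟩

/-! ### Labelled graphs and their columns -/

open Classical in
/-- The entries of the adjacency matrix. -/
noncomputable def adj (G : SimpleGraph ℕ) (i j : ℕ) : ℕ := if G.Adj i j then 1 else 0

section

variable {G G' : SimpleGraph ℕ} {i j k n v : ℕ} {σ τ : Equiv.Perm ℕ}

theorem adj_eq_one : adj G i j = 1 ↔ G.Adj i j := by simp [adj]

theorem adj_eq_zero : adj G i j = 0 ↔ ¬ G.Adj i j := by simp [adj]

theorem adj_zero_or_one : adj G i j = 0 ∨ adj G i j = 1 := by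
  rw [adj_eq_one, adj_eq_zero]; tauto

theorem adj_le_one : adj G i j ≤ 1 := by rcases adj_zero_or_one (G := G) (i := i) (j := j) <;> omega

open Classical in
theorem adj_comm (G : SimpleGraph ℕ) (i j : ℕ) : adj G i j = adj G j i :=
  if_congr (G.adj_comm i j) rfl rfl

@[simp] theorem adj_self : adj G i i = 0 := by simp [adj]

theorem adj_lt : adj G i j < 2 ^ 16 := adj_le_one.trans_lt (by norm_num)

open Classical in
theorem adj_congr (h : G.Adj i j ↔ G'.Adj i j) : adj G i j = adj G' i j :=
  if_congr h rfl rfl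

/-- The graph has no edges outside the vertices `0, …, 13`. -/
def Labelled (G : SimpleGraph ℕ) : Prop := ∀ i j, G.Adj i j → i < 14

theorem Labelled.adj_eq_zero (h : Labelled G) (hi : 14 ≤ j) : adj G i j = 0 :=
  SegmentCount.adj_eq_zero.2 fun hj => (h j i hj.symm).not_ge hi

/-- The adjacency matrix of the first `n` vertices. -/
noncomputable def mat (G : SimpleGraph ℕ) (n : ℕ) : ℕ := pack 256 n fun i => pack 16 n (adj G i)

theorem pack_lt_row (hn : n ≤ 14) {f : ℕ → ℕ} (hf : ∀ v < n, f v < 2 ^ 16) :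
    pack 16 n f < 2 ^ 256 :=
  (pack_lt hf).trans_le (Nat.pow_le_pow_right (by norm_num) (by omega))

theorem row_mat (hn : n ≤ 14) (hv : v < n) : row (mat G n) (16 * v) = pack 16 n (adj G v) := by
  change (mat G n >>> (16 * (16 * v))) % 2 ^ 256 = _
  rw [← mul_assoc]
  exact pack_shiftRight_mod (fun _ _ => pack_lt_row hn fun _ _ => adj_lt) hv

/-- The column of the vertex `v` with respect to the vertices `σ 0, …, σ (k - 1)`. -/
noncomputable def sg (G : SimpleGraph ℕ) (σ : Equiv.Perm ℕ) : ℕ → ℕ → ℕ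
  | 0, _ => 0
  | k + 1, v => 2 * sg G σ k v + adj G (σ k) v

/-- The column of the `k`th vertex `σ k` with respect to its predecessors. -/
noncomputable def col (G : SimpleGraph ℕ) (σ : Equiv.Perm ℕ) (k : ℕ) : ℕ := sg G σ k (σ k)

theorem sg_lt (G : SimpleGraph ℕ) (σ : Equiv.Perm ℕ) (k v : ℕ) : sg G σ k v < 2 ^ k := by
  induction k with
  | zero => simp [sg]
  | succ k ih =>
    have := adj_le_one (G := G) (i := σ k) (j := v)
    rw [sg, pow_succ]
    omega

theorem sg_congr (h : ∀ i < k, σ i = τ i) : sg G σ k v = sg G τ k v := by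
  induction k with
  | zero => rfl
  | succ k ih => rw [sg, sg, ih fun i hi => h i (by omega), h k (by omega)]

/-- Choosing vertices in the order `σ` amounts to relabelling the graph by `σ`, so `Maximal`
compares a graph with its relabelled copies. -/
theorem sg_comap : sg (G.comap σ) 1 k v = sg G σ k (σ v) := by
  induction k with
  | zero => rfl
  | succ k ih => rw [sg, sg, ih]; rfl

theorem col_comap : col (G.comap σ) 1 k = col G σ k := sg_comap

theorem sg_eq_zero (h : ∀ i < k, adj G (σ i) v = 0) : sg G σ k v = 0 := by
  induction k with
  | zero => rfl
  | succ k ih => rw [sg, ih fun i hi => h i (by omega), h k (by omega)]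

/-- Earlier vertices supply the more significant bits, so a strict inequality survives all later
ones. -/
theorem sg_lt_sg {w : ℕ} (hik : i ≤ k) (h : sg G σ i v < sg G σ i w) :
    sg G σ k v < sg G σ k w := by
  induction k, hik using Nat.le_induction with
  | base => exact h
  | succ k _ ih =>
    have := adj_le_one (G := G) (i := σ k) (j := v)
    rw [sg, sg]
    omega

theorem adj_eq_of_sg_eq {w : ℕ} {τ : Equiv.Perm ℕ} (h : sg G σ k v = sg G' τ k w) (hi : i < k) :
    adj G (σ i) v = adj G' (τ i) w := by
  induction k with
  | zero => omega
  | succ k ih =>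
    have h₁ := adj_le_one (G := G) (i := σ k) (j := v)
    have h₂ := adj_le_one (G := G') (i := τ k) (j := w)
    rw [sg, sg] at h
    rcases Nat.lt_succ_iff_lt_or_eq.1 hi with hi | rfl
    · exact ih (by omega) hi
    · omega

/-- The binary digits of the columns are the matrix entries above the diagonal. -/
theorem eq_of_col_eq (h : ∀ k, col G 1 k = col G' 1 k) : G = G' := by
  have key : ∀ i j, i < j → (G.Adj i j ↔ G'.Adj i j) := fun i j hij => by
    rw [← adj_eq_one, ← adj_eq_one]
    exact Eq.congr_left (adj_eq_of_sg_eq (h j) hij)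
  ext i j
  rcases lt_trichotomy i j with hij | rfl | hij
  · exact key i j hij
  · simp
  · rw [G.adj_comm, G'.adj_comm, key j i hij]

/-- A renaming of the vertices `2, …, 13`. -/
structure Renaming (σ : Equiv.Perm ℕ) : Prop where
  zero : σ 0 = 0
  one : σ 1 = 1
  large : ∀ i, 14 ≤ i → σ i = i

theorem Renaming.lt (h : Renaming σ) (hi : i < 14) : σ i < 14 := by
  by_contra hc
  have := σ.injective (h.large _ (not_lt.1 hc))
  omega

theorem Renaming.refl : Renaming 1 := ⟨rfl, rfl, fun _ _ => rfl⟩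

/-- No renaming yields lexicographically larger columns. -/
def Maximal (G : SimpleGraph ℕ) : Prop :=
  ∀ σ, Renaming σ → toLex (col G σ) ≤ toLex (col G 1)

/-! ### The maximality test -/

theorem two_pow_eq_pack (hv : v < n) : 2 ^ (16 * v) = pack 16 n fun x => if x = v then 1 else 0 := by
  simp [pack, hv]

theorem land_32768 {x : ℕ} (hx : x < 65536) :
    x &&& 32768 = if 32768 ≤ x then 32768 else 0 := by
  have h₁ : x.testBit 15 = decide (32768 ≤ x) := by
    rw [Nat.testBit_eq_decide_div_mod_eq]
    congr 1
    apply propext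
    omega
  have h₂ := Nat.and_two_pow x 15
  rw [h₁] at h₂
  norm_num at h₂
  rw [h₂]
  by_cases h : 32768 ≤ x <;> simp [h]

theorem check_cons_eq (A O H c : ℕ) (cs : List ℕ) (S U : ℕ) :
    check A O H (c :: cs) S U =
      sel (Nat.beq ((O * (32768 + c) + U * 16384 - S) &&& H) H)
        (allBits (fun e => check A O H cs (2 * S + row A e) (U + 2 ^ e)) 14
          ((H - ((O * (32768 + c) + U * 16384 - S - O) &&& H)) >>> 15)) false :=
  (show check A O H (c :: cs) S U = force (O * (32768 + c) + U * 16384 - S) fun T =>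
    sel (Nat.beq (T &&& H) H) (force ((H - ((T - O) &&& H)) >>> 15) (allBits (fun e =>
      force (2 * S + row A e) fun S' => check A O H cs S' (U + 2 ^ e)) 14)) false from rfl).trans
    (by simp only [force_eq])

/-- One subtraction compares all vertices with `c`. The field of `v` becomes `32768 + c - s v`, plus
`16384` if `v` is already chosen. Its bit 15 is set when `v` is chosen or `s v ≤ c`, so the mask `H`
detects a vertex that beats `c`. After subtracting `1` from each field, bit 15 is lost exactly at
the unchosen vertices with `s v = c`; only these ties need a recursive search. The bound `16384`
keeps the fields from interfering. -/
theorem check_cons (hn : n ≤ 14) {c : ℕ} {cs : List ℕ} {s u : ℕ → ℕ} (hc : c < 16384)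
    (hs : ∀ v < n, s v < 16384) (hu : ∀ v < n, u v = 0 ∨ u v = 1) :
    check (mat G n) (ones n) (ones n * 32768) (c :: cs) (pack 16 n s) (pack 16 n u) = true ↔
      ∀ v < n, u v = 0 → s v ≤ c ∧ (s v = c →
        check (mat G n) (ones n) (ones n * 32768) cs (pack 16 n fun x => 2 * s x + adj G v x)
          (pack 16 n fun x => u x + if x = v then 1 else 0) = true) := by
  set H := ones n * 32768 with hH
  have hHp : H = pack 16 n fun _ => 32768 := by rw [hH, ones_eq, pack_mul]
  set t : ℕ → ℕ := fun v => 32768 + c + u v * 16384 - s v with ht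
  have htlt : ∀ v < n, t v < 65536 := fun v hv => by
    rcases hu v hv with h | h <;> simp only [ht, h] <;> omega
  have hT : ones n * (32768 + c) + pack 16 n u * 16384 - pack 16 n s = pack 16 n t := by
    rw [ones_eq, pack_mul, pack_mul, pack_add, pack_sub]
    · exact pack_congr fun v _ => by simp only [ht, one_mul]
    · intro v hv
      have := hs v hv
      omega
  have hland : ∀ f : ℕ → ℕ, (∀ v < n, f v < 65536) →
      pack 16 n f &&& H = pack 16 n fun v => if 32768 ≤ f v then 32768 else 0 := fun f hf => by
    rw [hHp, pack_land (by norm_num) hf fun _ _ => by norm_num]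
    exact pack_congr fun v hv => land_32768 (hf v hv)
  have hstep : check (mat G n) (ones n) H (c :: cs) (pack 16 n s) (pack 16 n u) =
      sel (Nat.beq (pack 16 n t &&& H) H)
        (allBits (fun e => check (mat G n) (ones n) H cs (2 * pack 16 n s + row (mat G n) e)
          (pack 16 n u + 2 ^ e)) 14 ((H - ((pack 16 n t - ones n) &&& H)) >>> 15)) false := by
    rw [check_cons_eq, hT]
  have hfirst : pack 16 n t &&& H = H ↔ ∀ v < n, 32768 ≤ t v := by
    rw [hland t htlt, hHp, pack_inj]
    · refine forall₂_congr fun v _ => ?_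
      split_ifs with h <;> simp [h]
    · intro v _; split_ifs <;> norm_num
    · intro v _; norm_num
  have hsecond (h : ∀ v < n, 32768 ≤ t v) : (H - ((pack 16 n t - ones n) &&& H)) >>> 15 =
      pack 16 n fun v => if t v = 32768 then 1 else 0 := by
    rw [ones_eq, pack_sub fun v hv => (by norm_num : 1 ≤ 32768).trans (h v hv),
      hland _ fun v hv => (Nat.sub_le _ _).trans_lt (htlt v hv), hHp, pack_sub]
    · rw [Nat.shiftRight_eq_div_pow, pack_congr (g := fun v => 2 ^ 15 * if t v = 32768 then 1 else 0),
        ← mul_pack, Nat.mul_div_cancel_left _ (by positivity)]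
      intro v hv
      have := h v hv
      split_ifs <;> omega
    · intro v _; split_ifs <;> norm_num
  rw [hstep, sel_eq_true, nat_beq_eq_true, hfirst]
  have hle : ∀ v < n, (32768 ≤ t v ↔ (u v = 0 → s v ≤ c)) := fun v hv => by
    have := hs v hv
    rcases hu v hv with h | h
    · simp only [ht, h, forall_const]
      omega
    · simp only [ht, h, one_ne_zero, false_implies, iff_true]
      omega
  have heq : ∀ v < n, (t v = 32768 ↔ u v = 0 ∧ s v = c) := fun v hv => by
    have := hs v hv
    rcases hu v hv with h | h
    · simp only [ht, h, eq_self, true_and]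
      omega
    · simp only [ht, h, one_ne_zero, false_and, iff_false]
      omega
  simp only [Bool.false_eq_true, and_false, or_false]
  by_cases h : ∀ v < n, 32768 ≤ t v
  · rw [hsecond h, allBits_pack hn fun v _ => by split_ifs <;> simp]
    refine (and_iff_right h).trans ?_
    refine forall₂_congr fun v hv => ?_
    have h₁ := (hle v hv).1 (h v hv)
    have h₂ : (if t v = 32768 then 1 else 0) = 1 ↔ u v = 0 ∧ s v = c := by
      rw [← heq v hv]; split_ifs <;> simp_all
    rw [h₂, row_mat hn hv, two_pow_eq_pack hv, mul_pack, pack_add, pack_add]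
    constructor
    · exact fun h₃ h₄ => ⟨h₁ h₄, fun h₅ => h₃ ⟨h₄, h₅⟩⟩
    · exact fun h₃ h₄ => (h₃ h₄.1).2 h₄.2
  · refine iff_of_false (fun h' => h h'.1) fun h' => h fun v hv => ?_
    exact (hle v hv).2 fun h₁ => (h' v hv h₁).1

open Classical in
/-- The marks of the vertices `σ 0, …, σ (k - 1)`. -/
noncomputable def used (σ : Equiv.Perm ℕ) (k v : ℕ) : ℕ := if ∃ i < k, σ i = v then 1 else 0

theorem used_eq_zero : used σ k v = 0 ↔ ∀ i < k, σ i ≠ v := by simp [used]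

theorem used_zero_or_one : used σ k v = 0 ∨ used σ k v = 1 := by
  unfold used; split_ifs <;> simp

theorem used_succ : used σ (k + 1) v = used σ k v + if v = σ k then 1 else 0 := by
  have h₁ : (∃ i < k + 1, σ i = v) ↔ (∃ i < k, σ i = v) ∨ σ k = v := by
    simp only [Nat.lt_succ_iff_lt_or_eq, or_and_right, exists_or, exists_eq_left]
  have h₂ : σ k = v → ¬ ∃ i < k, σ i = v := by
    rintro rfl ⟨i, hi, h⟩
    exact hi.ne (σ.injective h)
  unfold used
  rw [if_congr h₁ rfl rfl]
  by_cases h : σ k = v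
  · rw [if_pos (.inr h), if_neg (h₂ h), if_pos h.symm]
  · rw [if_congr (or_iff_left h) rfl rfl, if_neg (Ne.symm h), add_zero]

theorem used_congr (h : ∀ i < k, σ i = τ i) : used σ k v = used τ k v :=
  if_congr (exists_congr fun i => and_congr_right fun hi => by rw [h i hi]) rfl rfl

/-- The test for the columns from `k` on, after the choice of `σ 0, …, σ (k - 1)`. -/
noncomputable def checkFrom (G : SimpleGraph ℕ) (n : ℕ) (σ : Equiv.Perm ℕ) (k m : ℕ) : Bool :=
  check (mat G n) (ones n) (ones n * 32768) ((List.range' k m).map (col G 1))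
    (pack 16 n (sg G σ k)) (pack 16 n (used σ k))

theorem checkFrom_congr (h : ∀ i < k, σ i = τ i) {m : ℕ} :
    checkFrom G n σ k m = checkFrom G n τ k m := by
  unfold checkFrom
  rw [pack_congr fun v _ => sg_congr h, pack_congr (f := used σ k) fun v _ => used_congr h]

/-- The remaining test depends only on the chosen initial values, so one extension `τ` with `τ k =
v` is as good as all of them. -/
theorem checkFrom_succ (hn : n ≤ 14) {m : ℕ} (hk : k ≤ 13) :
    checkFrom G n σ k (m + 1) = true ↔ ∀ v < n, (∀ i < k, σ i ≠ v) →
      sg G σ k v ≤ col G 1 k ∧ (sg G σ k v = col G 1 k →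
        ∀ τ : Equiv.Perm ℕ, (∀ i < k, τ i = σ i) → τ k = v →
          checkFrom G n τ (k + 1) m = true) := by
  have hlt : 2 ^ k < 16384 :=
    (Nat.pow_le_pow_right (by norm_num) hk).trans_lt (by norm_num : 2 ^ 13 < 16384)
  have hstep := check_cons (G := G) hn (c := col G 1 k) (u := used σ k)
    (cs := (List.range' (k + 1) m).map (col G 1))
    ((sg_lt G 1 k _).trans hlt) (fun v _ => (sg_lt G σ k v).trans hlt)
    fun v _ => used_zero_or_one
  unfold checkFrom
  rw [List.range'_succ, List.map_cons, hstep]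
  refine forall₂_congr fun v hv => ?_
  rw [used_eq_zero]
  refine forall_congr' fun hv' => and_congr_right fun _ => forall_congr' fun _ => ?_
  have key : ∀ τ : Equiv.Perm ℕ, (∀ i < k, τ i = σ i) → τ k = v →
      (pack 16 n (fun x => 2 * sg G σ k x + adj G v x) = pack 16 n (sg G τ (k + 1)) ∧
      (pack 16 n fun x => used σ k x + if x = v then 1 else 0) = pack 16 n (used τ (k + 1))) := by
    intro τ h₁ h₂
    refine ⟨pack_congr fun x _ => ?_, pack_congr fun x _ => ?_⟩
    · rw [sg, sg_congr h₁, h₂]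
    · rw [used_succ, used_congr h₁, h₂]
  constructor
  · intro h τ h₁ h₂
    rwa [← (key τ h₁ h₂).1, ← (key τ h₁ h₂).2]
  · intro h
    -- The transposition brings `v` to place `k`. Its other index is not below `k`, as `v` is not
    -- yet chosen, so the earlier values stay.
    have h₁ : ∀ i < k, (σ * Equiv.swap k (σ.symm v)) i = σ i := fun i hi => by
      rw [Equiv.Perm.mul_apply, Equiv.swap_apply_of_ne_of_ne hi.ne]
      rintro rfl
      exact hv' _ hi (by simp)
    have h₂ : (σ * Equiv.swap k (σ.symm v)) k = v := by simp
    rw [(key _ h₁ h₂).1, (key _ h₁ h₂).2]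
    exact h _ h₁ h₂

/-- As long as the columns agree, `σ` follows a branch of ties that the test has explored; at `l`
the test on that branch gives the inequality. -/
theorem col_le_of_checkFrom {m : ℕ} (hσ : Renaming σ) (hkm : k + m = 14)
    (h : checkFrom G 14 σ k m = true) {l : ℕ} (hkl : k ≤ l) (hl : l < 14)
    (heq : ∀ i, k ≤ i → i < l → col G σ i = col G 1 i) : col G σ l ≤ col G 1 l := by
  induction m generalizing k with
  | zero => omega
  | succ m ih =>
    have h₁ := (checkFrom_succ le_rfl (by omega)).1 h (σ k) (hσ.lt (by omega))
      fun i hi => σ.injective.ne hi.ne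
    rcases hkl.eq_or_lt with rfl | hkl'
    · exact h₁.1
    · exact ih (by omega) (h₁.2 (heq k le_rfl hkl') σ (fun _ _ => rfl) rfl) hkl'
        fun i hi => heq i (by omega)

/-- A partial relabelling of the first `n` vertices extends to a renaming of all fourteen without
changing the columns already fixed. If it won at place `k`, that renaming would contradict
maximality. Allowing every `n ≤ 14` is what justifies pruning incomplete graphs. -/
theorem Maximal.checkFrom (hG : Maximal G) (hn : n ≤ 14) {m : ℕ} (hσ : Renaming σ) (hk : 2 ≤ k)
    (hkm : k + m = n) (heq : ∀ i < k, col G σ i = col G 1 i) : checkFrom G n σ k m = true := by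
  induction m generalizing k σ with
  | zero => rfl
  | succ m ih =>
    have key : ∀ v < n, (∀ i < k, σ i ≠ v) → Renaming (σ * Equiv.swap k (σ.symm v)) ∧
        (∀ i < k, (σ * Equiv.swap k (σ.symm v)) i = σ i) := by
      intro v hv hv'
      have h₁ : k ≤ σ.symm v := by
        by_contra hc
        exact hv' _ (not_le.1 hc) (by simp)
      have h₂ : σ.symm v < 14 := by
        by_contra hc
        have := hσ.large _ (not_lt.1 hc)
        rw [Equiv.apply_symm_apply] at this
        omega
      have h₃ : ∀ i, i ≠ k → i ≠ σ.symm v → (σ * Equiv.swap k (σ.symm v)) i = σ i :=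
        fun i h h' => by rw [Equiv.Perm.mul_apply, Equiv.swap_apply_of_ne_of_ne h h']
      refine ⟨⟨?_, ?_, fun i hi => ?_⟩, fun i hi => h₃ i (by omega) (by omega)⟩
      · rw [h₃ 0 (by omega) (by omega), hσ.zero]
      · rw [h₃ 1 (by omega) (by omega), hσ.one]
      · rw [h₃ i (by omega) (by omega), hσ.large i hi]
    refine (checkFrom_succ hn (by omega)).2 fun v hv hv' => ?_
    obtain ⟨h₁, h₂⟩ := key v hv hv'
    set ρ := σ * Equiv.swap k (σ.symm v)
    have hρk : ρ k = v := by simp [ρ]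
    have hcol : ∀ i < k, col G ρ i = col G 1 i := fun i hi => by
      rw [← heq i hi, col, col, h₂ i hi, sg_congr fun j hj => h₂ j (by omega)]
    have hcolk : col G ρ k = sg G σ k v := by rw [col, hρk, sg_congr h₂]
    refine ⟨?_, fun h₃ τ h₄ h₅ => ?_⟩
    · by_contra hc
      refine (hG ρ h₁).not_gt ⟨k, fun i hi => (hcol i hi).symm, ?_⟩
      change col G 1 k < col G ρ k
      rw [hcolk]
      exact not_le.1 hc
    · have h₆ : ∀ i < k + 1, τ i = ρ i := fun i hi => by
        rcases Nat.lt_succ_iff_lt_or_eq.1 hi with hi | rfl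
        · rw [h₄ i hi, h₂ i hi]
        · rw [h₅, hρk]
      rw [checkFrom_congr h₆]
      refine ih h₁ (by omega) (by omega) fun i hi => ?_
      rcases Nat.lt_succ_iff_lt_or_eq.1 hi with hi | rfl
      · exact hcol i hi
      · rw [hcolk, h₃]

theorem columns_succ {α : Type} (A m S e : ℕ) (F : List ℕ → α) :
    columns A (m + 1) S e F =
      columns A m (2 * S + row A e) (e + 16) fun cs => F ((S >>> e) % 65536 :: cs) :=
  (show columns A (m + 1) S e F = force ((S >>> e) % 65536) fun c =>
    columns A m (2 * S + row A e) (e + 16) fun cs => F (c :: cs) from rfl).trans (force_eq _ _)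

theorem columns_mat {α : Type} (hn : n ≤ 14) {m : ℕ} (hkm : k + m = n) (F : List ℕ → α) :
    columns (mat G n) m (pack 16 n (sg G 1 k)) (16 * k) F =
      F ((List.range' k m).map (col G 1)) := by
  induction m generalizing k F with
  | zero => rfl
  | succ m ih =>
    have hlt : ∀ v < n, sg G 1 k v < 2 ^ 16 := fun v _ =>
      (sg_lt G 1 k v).trans_le (Nat.pow_le_pow_right (by norm_num) (by omega))
    rw [columns_succ, show 65536 = 2 ^ 16 by norm_num, pack_shiftRight_mod hlt (by omega),
      row_mat hn (by omega), mul_pack, pack_add, ← mul_add_one 16 k]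
    exact ih (k := k + 1) (by omega) _

theorem isMax_mat (hn : n ≤ 14) (hn' : 2 ≤ n) : isMax n (mat G n) = checkFrom G n 1 2 (n - 2) := by
  have h₀ := row_mat (G := G) hn (by omega : 0 < n)
  have h₁ := row_mat (G := G) hn (by omega : 1 < n)
  have hS : 2 * row (mat G n) 0 + row (mat G n) 16 = pack 16 n (sg G 1 2) := by
    rw [h₀, h₁, mul_pack, pack_add]
    exact pack_congr fun v _ => by simp [sg]
  have hU : 65537 = pack 16 n (used 1 2) := by
    rw [pack_congr (g := fun x => (if x = 0 then 1 else 0) + if x = 1 then 1 else 0), ← pack_add,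
      ← two_pow_eq_pack (by omega), ← two_pow_eq_pack (by omega)]
    · norm_num
    · intro v _
      rw [used_succ, used_succ]
      simp only [used, not_lt_zero, false_and, exists_false, if_false, zero_add,
        Equiv.Perm.one_apply]
      rfl
  unfold isMax
  rw [force_eq, force_eq, nat_add_eq, nat_mul_eq, nat_mul_eq, nat_sub_eq, hS, hU]
  exact columns_mat hn (k := 2) (by omega) _

theorem Maximal.isMax (hG : Maximal G) (hn : n ≤ 14) (hn' : 2 ≤ n) :
    isMax n (mat G n) = true := by
  rw [isMax_mat hn hn']
  exact hG.checkFrom hn Renaming.refl le_rfl (by omega) fun _ _ => rfl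

/-- The first place where a better renaming could differ is among `2, …, 13`: columns `0` and `1`
are fixed, and those from `14` on vanish. The test covers exactly these places. -/
theorem maximal_of_isMax (hG : Labelled G) (h : SegmentCount.isMax 14 (mat G 14) = true) :
    Maximal G := by
  rw [isMax_mat le_rfl (by norm_num)] at h
  intro σ hσ
  by_contra hc
  obtain ⟨l, h₁, h₂⟩ := not_le.1 hc
  change ∀ j < l, col G 1 j = col G σ j at h₁
  change col G 1 l < col G σ l at h₂
  have hl : l < 14 := by
    by_contra hl
    have : col G σ l = 0 := by
      rw [col, hσ.large l (not_lt.1 hl)]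
      exact sg_eq_zero fun i _ => hG.adj_eq_zero (not_lt.1 hl)
    omega
  have hl' : 2 ≤ l := by
    by_contra hl'
    interval_cases l
    · simp [col, sg] at h₂
    · simp [col, sg, hσ.zero, hσ.one] at h₂
  have hσ' : checkFrom G 14 σ 2 12 = true := by
    rw [checkFrom_congr (τ := 1)]
    · exact h
    · intro i hi
      interval_cases i
      · exact hσ.zero
      · exact hσ.one
  exact h₂.not_ge (col_le_of_checkFrom hσ rfl hσ' hl' hl fun i _ hi => (h₁ i hi).symm)

end

section

variable {G G' : SimpleGraph ℕ} {i j k m n r v A D t x : ℕ}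

/-! ### Degrees and common neighbours -/

/-- The number of neighbours of `i` among the first `k` vertices. -/
noncomputable def deg (G : SimpleGraph ℕ) (k i : ℕ) : ℕ := ∑ j ∈ Finset.range k, adj G i j

/-- The number of common neighbours of `i` and `j` among the first `k` vertices. -/
noncomputable def common (G : SimpleGraph ℕ) (k i j : ℕ) : ℕ :=
  ∑ w ∈ Finset.range k, adj G i w * adj G j w

/-- The degrees of the graph on the first `n` vertices. -/
noncomputable def degs (G : SimpleGraph ℕ) (n : ℕ) : ℕ := pack 16 n (deg G n)

theorem deg_succ : deg G (k + 1) i = deg G k i + adj G i k := Finset.sum_range_succ _ _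

theorem deg_mono (h : k ≤ m) : deg G k i ≤ deg G m i :=
  Finset.sum_le_sum_of_subset (Finset.range_mono h)

theorem deg_le : deg G k i ≤ k :=
  (Finset.sum_le_card_nsmul (Finset.range k) (adj G i) 1 fun _ _ => adj_le_one).trans (by simp)

theorem deg_add_le : deg G (k + m) i ≤ deg G k i + m := by
  induction m with
  | zero => simp
  | succ m ih =>
    have := adj_le_one (G := G) (i := i) (j := k + m)
    rw [← add_assoc, deg_succ]
    omega

theorem deg_lt_deg (h : G.Adj i j) (hk : k ≤ j) (hj : j < n) : deg G k i < deg G n i := by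
  have h₁ := deg_mono (G := G) (i := i) hk
  have h₂ := deg_mono (G := G) (i := i) (Nat.succ_le_iff.2 hj)
  rw [Nat.succ_eq_add_one, deg_succ, adj_eq_one.2 h] at h₂
  omega

theorem exists_adj_of_deg_lt (h : deg G k i < deg G n i) : ∃ j, k ≤ j ∧ j < n ∧ G.Adj i j := by
  by_contra hc
  refine h.not_ge ?_
  refine Finset.sum_le_sum_of_ne_zero fun j hj hj' => Finset.mem_range.2 ?_
  by_contra hkj
  exact hc ⟨j, not_lt.1 hkj, Finset.mem_range.1 hj, by_contra fun h => hj' (adj_eq_zero.2 h)⟩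

theorem common_mono (h : k ≤ m) : common G k i j ≤ common G m i j :=
  Finset.sum_le_sum_of_subset (Finset.range_mono h)

theorem common_le_deg : common G k i j ≤ deg G k i :=
  Finset.sum_le_sum fun w _ => by
    simpa using Nat.mul_le_mul_left (adj G i w) (adj_le_one (G := G) (i := j) (j := w))

theorem common_comm : common G k i j = common G k j i :=
  Finset.sum_congr rfl fun _ _ => mul_comm _ _

theorem common_eq_zero : common G k i j = 0 ↔ ∀ w < k, ¬ (G.Adj i w ∧ G.Adj j w) := by
  simp only [common, Finset.sum_eq_zero_iff, Finset.mem_range, mul_eq_zero, adj_eq_zero]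
  exact forall₂_congr fun _ _ => by tauto

theorem degs_lt (hn : n ≤ 14) : ∀ v < n, deg G n v < 2 ^ 16 := fun _ _ =>
  (deg_le.trans hn).trans_lt (by norm_num)

theorem mat_congr (h : ∀ i < n, ∀ j < n, G.Adj i j ↔ G'.Adj i j) : mat G n = mat G' n :=
  pack_congr fun i hi => pack_congr fun j hj => adj_congr (h i hi j hj)

theorem degs_congr (h : ∀ i < n, ∀ j < n, G.Adj i j ↔ G'.Adj i j) : degs G n = degs G' n :=
  pack_congr fun i hi => Finset.sum_congr rfl fun j hj =>
    adj_congr (h i hi j (Finset.mem_range.1 hj))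

theorem mat_injective (hG : Labelled G) (hG' : Labelled G') (h : mat G 14 = mat G' 14) :
    G = G' := by
  have hlt : ∀ G : SimpleGraph ℕ, ∀ v < 14, pack 16 14 (adj G v) < 2 ^ 256 := fun _ _ _ =>
    pack_lt_row le_rfl fun _ _ => adj_lt
  have h₁ := (pack_inj (hlt G) (hlt G')).1 h
  ext i j
  by_cases hij : i < 14 ∧ j < 14
  · have h₂ := (pack_inj (fun _ _ => adj_lt) fun _ _ => adj_lt).1 (h₁ i hij.1) j hij.2
    rw [← adj_eq_one, h₂, adj_eq_one]
  · exact iff_of_false (fun h => hij ⟨hG _ _ h, hG _ _ h.symm⟩)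
      fun h => hij ⟨hG' _ _ h, hG' _ _ h.symm⟩

/-- The common neighbours of two vertices, from the rows of the matrix. -/
theorem row_land_row (hi : i < 14) (hj : j < 14) :
    row (mat G 14) (16 * i) &&& row (mat G 14) (16 * j) =
      pack 16 14 fun w => adj G i w * adj G j w := by
  rw [row_mat le_rfl hi, row_mat le_rfl hj,
    pack_land (by norm_num) (fun _ _ => adj_lt) fun _ _ => adj_lt]
  refine pack_congr fun w _ => ?_
  rcases adj_zero_or_one (G := G) (i := i) (j := w) with h | h <;>
  rcases adj_zero_or_one (G := G) (i := j) (j := w) with h' | h' <;> simp [h, h']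

theorem row_land_row_mod (hi : i < 14) (hj : j < 14) :
    (row (mat G 14) (16 * i) &&& row (mat G 14) (16 * j)) % 65535 = common G 14 i j := by
  rw [row_land_row hi hj, pack_mod, Nat.mod_eq_of_lt]
  · rfl
  · exact (common_le_deg.trans deg_le).trans_lt (by norm_num)

/-- A labelled graph with the edge `01` that comes from a good cubic graph. -/
structure Good (G : SimpleGraph ℕ) : Prop where
  labelled : Labelled G
  deg_eq : ∀ i < 14, deg G 14 i = 3
  common_le : ∀ i < 14, ∀ j < 14, i ≠ j → ¬ G.Adj i j → common G 14 i j ≤ 1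
  edge : G.Adj 0 1
  common_eq : common G 14 0 1 = 0

theorem allBelow_eq_true {P : ℕ → Bool} : allBelow P n = true ↔ ∀ i < n, P i = true := by
  induction n with
  | zero => simp [allBelow]
  | succ n ih =>
    rw [Nat.forall_lt_succ_right, ← ih]
    change sel (P n) (allBelow P n) false = true ↔ _
    simp [and_comm]

theorem pairTest_eq : pairTest A i = allBelow (fun j =>
    sel (Nat.beq ((row A (16 * i) >>> (16 * j)) % 65536) 1) true
      (Nat.ble ((row A (16 * i) &&& row A (16 * j)) % 65535) 1)) i := by
  rw [pairTest, force_eq]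
  rfl

theorem pairTest_mat (hi : i < 14) : pairTest (mat G 14) i = true ↔
    ∀ j < i, ¬ G.Adj i j → common G 14 i j ≤ 1 := by
  rw [pairTest_eq, allBelow_eq_true]
  refine forall₂_congr fun j hj => ?_
  have h₁ : (row (mat G 14) (16 * i) >>> (16 * j)) % 65536 = adj G i j := by
    rw [row_mat le_rfl hi]
    exact pack_shiftRight_mod (fun _ _ => adj_lt) (hj.trans hi)
  rw [h₁, row_land_row_mod hi (hj.trans hi), sel_eq_true, nat_beq_eq_true, nat_beq_eq_false,
    nat_ble_eq_true, ← adj_eq_one]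
  by_cases h : adj G i j = 1 <;> simp [h]

theorem commonTest_mat : commonTest (mat G 14) = true ↔ common G 14 0 1 = 0 ∧
    ∀ i < 14, ∀ j < 14, i ≠ j → ¬ G.Adj i j → common G 14 i j ≤ 1 := by
  have h₀ := row_land_row_mod (G := G) (i := 0) (j := 1) (by norm_num) (by norm_num)
  rw [mul_zero, mul_one] at h₀
  rw [commonTest, nat_land_eq, nat_mod_eq, h₀, sel_eq_true, nat_beq_eq_true, allBelow_eq_true]
  simp only [Bool.false_eq_true, and_false, or_false]
  refine and_congr_right fun _ => ?_
  constructor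
  · intro h i hi j hj hij hadj
    rcases hij.lt_or_gt with hlt | hlt
    · rw [common_comm]
      exact (pairTest_mat hj).1 (h j hj) i hlt fun h => hadj h.symm
    · exact (pairTest_mat hi).1 (h i hi) j hlt hadj
  · intro h i hi
    exact (pairTest_mat hi).2 fun j hj => h i hi j (hj.trans hi) hj.ne'

theorem degs_eq_iff : degs G 14 = 3 * ones 14 ↔ ∀ i < 14, deg G 14 i = 3 := by
  rw [ones_eq, mul_pack, degs, pack_inj (degs_lt le_rfl) fun _ _ => by norm_num]

theorem accept_iff : accept (mat G 14) (degs G 14) = true ↔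
    (∀ i < 14, deg G 14 i = 3) ∧ isMax 14 (mat G 14) = true ∧ common G 14 0 1 = 0 ∧
    ∀ i < 14, ∀ j < 14, i ≠ j → ¬ G.Adj i j → common G 14 i j ≤ 1 := by
  rw [← commonTest_mat, ← degs_eq_iff, ← nat_beq_eq_true]
  change sel (Nat.beq (degs G 14) (3 * ones 14)) _ _ = true ↔ _
  simp

/-! ### Adding a vertex -/

/-- The sum of the items of the neighbours of the vertex `k`. -/
noncomputable def itemSum (G : SimpleGraph ℕ) (k : ℕ) : ℕ :=
  ∑ j ∈ Finset.range k, adj G k j * item (mat G k) (16 * j)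

theorem item_eq (A e : ℕ) :
    item A e = 2 ^ e + (row A e * 2 ^ 256 + 2 ^ (16 * e + 512)) := rfl

/-- The sum of the items has three parts: the new row, the numbers of common neighbours with the new
vertex (a sum of rows, after exchanging summations), and the new column in matrix format. The first
two fit into `256` bits each, so they can be separated again. -/
theorem itemSum_eq (hk : k ≤ 14) : itemSum G k =
    pack 16 k (adj G k) + 2 ^ 256 * (pack 16 k (common G k k) + 2 ^ 256 * pack 256 k (adj G k)) := by
  have h₁ : ∀ j ∈ Finset.range k, adj G k j * item (mat G k) (16 * j) =
      adj G k j * 2 ^ (16 * j) + 2 ^ 256 * (adj G k j * pack 16 k (adj G j) +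
        2 ^ 256 * (adj G k j * 2 ^ (256 * j))) := fun j hj => by
    have h₃ : 2 ^ (16 * (16 * j) + 512) = 2 ^ (256 * j) * (2 ^ 256 * 2 ^ 256) := by
      rw [← pow_add, ← pow_add, ← mul_assoc]
      norm_num only
    rw [item_eq, h₃, row_mat hk (Finset.mem_range.1 hj)]
    generalize 2 ^ 256 = W
    ring
  have h₂ : pack 16 k (common G k k) =
      ∑ j ∈ Finset.range k, adj G k j * pack 16 k (adj G j) := by
    simp only [pack, common, Finset.mul_sum, Finset.sum_mul]
    rw [Finset.sum_comm]
    refine Finset.sum_congr rfl fun j _ => Finset.sum_congr rfl fun v _ => ?_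
    rw [adj_comm G v j, mul_assoc]
  rw [itemSum, Finset.sum_congr rfl h₁, Finset.sum_add_distrib, ← Finset.mul_sum,
    Finset.sum_add_distrib, ← Finset.mul_sum, h₂]
  rfl

theorem itemSum_mod (hk : k ≤ 14) : itemSum G k % 2 ^ 256 = pack 16 k (adj G k) := by
  rw [itemSum_eq hk, Nat.add_mul_mod_self_left,
    Nat.mod_eq_of_lt (pack_lt_row hk fun _ _ => adj_lt)]

theorem itemSum_shiftRight (hk : k ≤ 14) : itemSum G k >>> 256 =
    pack 16 k (common G k k) + 2 ^ 256 * pack 256 k (adj G k) := by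
  rw [itemSum_eq hk, Nat.shiftRight_eq_div_pow, Nat.add_mul_div_left _ _ (by positivity),
    Nat.div_eq_of_lt (pack_lt_row hk fun _ _ => adj_lt), zero_add]

theorem common_lt (hk : k ≤ 14) : common G k i j < 2 ^ 16 :=
  ((common_le_deg.trans deg_le).trans hk).trans_lt (by norm_num)

theorem itemSum_shiftRight_mod (hk : k ≤ 14) :
    (itemSum G k >>> 256) % 2 ^ 256 = pack 16 k (common G k k) := by
  rw [itemSum_shiftRight hk, Nat.add_mul_mod_self_left,
    Nat.mod_eq_of_lt (pack_lt_row hk fun _ _ => common_lt hk)]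

theorem itemSum_shiftRight_512 (hk : k ≤ 14) : itemSum G k >>> 512 = pack 256 k (adj G k) := by
  rw [show 512 = 256 + 256 by norm_num, Nat.shiftRight_add, itemSum_shiftRight hk,
    Nat.shiftRight_eq_div_pow, Nat.add_mul_div_left _ _ (by positivity),
    Nat.div_eq_of_lt (pack_lt_row hk fun _ _ => common_lt hk), zero_add]

theorem addRow_mat (hk : k ≤ 14) :
    addRow k (mat G k) (itemSum G k % 2 ^ 256) (itemSum G k) = mat G (k + 1) := by
  rw [itemSum_mod hk]
  change mat G k + (pack 16 k (adj G k) * 2 ^ (256 * k) +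
    (itemSum G k >>> 512) * 2 ^ (16 * k)) = _
  rw [itemSum_shiftRight_512 hk, mat, mat, pack_succ (n := k) (w := 256), pack_succ (n := k),
    adj_self, zero_mul, add_zero, add_comm (pack 16 k (adj G k) * _), ← add_assoc, pack_mul,
    pack_add]
  congr 1
  refine pack_congr fun v _ => ?_
  rw [pack_succ, adj_comm G k v]

theorem addDeg_degs (hk : k ≤ 14) :
    addDeg k (degs G k) (itemSum G k % 2 ^ 256) = degs G (k + 1) := by
  rw [itemSum_mod hk]
  change degs G k + (pack 16 k (adj G k) + (pack 16 k (adj G k) % 65535) * 2 ^ (16 * k)) = _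
  have h : pack 16 k (adj G k) % 65535 = deg G (k + 1) k := by
    rw [pack_mod, deg_succ, adj_self, add_zero]
    exact Nat.mod_eq_of_lt ((deg_le (G := G) (i := k)).trans_lt (hk.trans_lt (by norm_num)))
  rw [h, degs, degs, pack_succ (n := k), ← add_assoc, pack_add]
  congr 1
  refine pack_congr fun v _ => ?_
  rw [deg_succ, adj_comm G k v]

/-- For `d ≤ 3`, bit 2 of `d + 1` is set only if `d = 3`. No such bound is assumed here, so the mark
remains a bit test; `mem_openList` turns it into `d < 3` for good graphs. -/
theorem unsaturated_degs (hk : k ≤ 14) : unsaturated (ones k) (degs G k) =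
    pack 16 k fun v => if (deg G k v + 1) &&& 4 = 0 then 1 else 0 := by
  have hd : ∀ v, deg G k v + 1 < 16 := fun v => by
    have := (deg_le (G := G) (i := v)).trans hk
    omega
  have h4 : ∀ d < 16, d &&& 4 = if d &&& 4 = 0 then 0 else 4 := by decide
  change (ones k * 4 - ((degs G k + ones k) &&& (ones k * 4))) >>> 2 = _
  rw [ones_eq, degs, pack_mul, pack_add, pack_land (by norm_num)
    (fun v _ => (hd v).trans (by norm_num)) (fun _ _ => by norm_num), pack_sub,
    Nat.shiftRight_eq_div_pow, pack_congr (f := fun v => 1 * 4 - ((deg G k v + 1) &&& 1 * 4))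
      (g := fun v => 2 ^ 2 * if (deg G k v + 1) &&& 4 = 0 then 1 else 0),
    ← mul_pack, Nat.mul_div_cancel_left _ (by positivity)]
  · intro v _
    have := h4 _ (hd v)
    by_cases h : (deg G k v + 1) &&& 4 = 0
    · rw [if_pos h, one_mul, h]
      norm_num
    · rw [if_neg h] at this
      rw [if_neg h, one_mul, this]
      norm_num
  · intro v _
    exact Nat.and_le_right

/-! ### The exploration -/

theorem collect_eq {α : Type} (F : List ℕ → α) (fuel E : ℕ) (l : List ℕ) :
    collect A F fuel E l = F (collect A id fuel E l) := by
  induction fuel generalizing E l with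
  | zero => rfl
  | succ fuel ih =>
    have hstep : ∀ {β : Type} (F : List ℕ → β), collect A F (fuel + 1) E l =
        sel (Nat.beq E 0) (F l) (collect A F fuel (E - 2 ^ Nat.log2 E)
          (item A (Nat.log2 E) :: l)) := fun F =>
      (show collect A F (fuel + 1) E l = sel (Nat.beq E 0) (F l)
        (force (Nat.log2 E) fun e => force (item A e) fun t =>
          collect A F fuel (E - 2 ^ e) (t :: l)) from rfl).trans (by simp only [force_eq])
    rw [hstep, hstep, ih]
    cases Nat.beq E 0 <;> rfl

/-- The tests that the sum of items `t` has to pass. -/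
noncomputable def passes (r A D t : ℕ) : Bool :=
  sel (admissible (ones (13 - r)) t (t % 2 ^ 256))
    (sel (sel (Nat.ble 3 r) true (minDeg (ones (14 - r)) (addDeg (13 - r) D (t % 2 ^ 256)) r))
      (sel (Nat.ble 3 r) (isMax (14 - r) (addRow (13 - r) A (t % 2 ^ 256) t)) true) false) false

/-- All the nested tests lead to the same alternative, so they merge into the single test `passes`.
-/
theorem explore_succ (acc : List ℕ) : explore (r + 1) A D acc =
    List.rec acc (fun t _ rest => sel (passes r A D t)
        (explore r (addRow (13 - r) A (t % 2 ^ 256) t) (addDeg (13 - r) D (t % 2 ^ 256)) rest) rest)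
      (candidates (collect A id 14 (unsaturated (ones (13 - r)) D) [])) := by
  have hsel : ∀ (a b c : Bool) (x y : List ℕ),
      sel a (sel b (sel c x y) y) y = sel (sel a (sel b c false) false) x y := by
    intro a b c x y
    cases a <;> cases b <;> rfl
  refine Eq.trans (show explore (r + 1) A D acc = force (ones (13 - r)) fun O =>
      collect A (fun U => List.rec acc (fun t _ rest =>
        force (t % 2 ^ 256) fun b => sel (admissible O t b)
          (force (addDeg (13 - r) D b) fun D' =>
            sel (sel (Nat.ble 3 r) true (minDeg (ones (14 - r)) D' r))
              (force (addRow (13 - r) A b t) fun A' =>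
                sel (sel (Nat.ble 3 r) (isMax (14 - r) A') true) (explore r A' D' rest) rest)
              rest)
          rest) (candidates U)) 14 (unsaturated O D) [] from rfl) ?_
  simp only [force_eq]
  rw [collect_eq]
  simp only [hsel, passes]

/-- The search only adds to its accumulator, so membership can be studied with an empty one. -/
theorem mem_explore {acc : List ℕ} : x ∈ explore r A D acc ↔ x ∈ acc ∨ x ∈ explore r A D [] := by
  induction r generalizing A D acc with
  | zero =>
    change x ∈ sel (accept A D) (A :: acc) acc ↔ x ∈ acc ∨ x ∈ sel (accept A D) [A] []
    cases accept A D <;> simp [sel, or_comm]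
  | succ r ih =>
    rw [explore_succ, explore_succ]
    induction candidates (collect A id 14 (unsaturated (ones (13 - r)) D) []) with
    | nil => simp
    | cons t l ihl =>
      dsimp only
      cases passes r A D t
      · exact ihl
      · rw [sel_true, sel_true, ih, ihl, ih (acc := List.rec _ _ l)]
        tauto

theorem mem_explore_succ : x ∈ explore (r + 1) A D [] ↔
    ∃ t ∈ candidates (collect A id 14 (unsaturated (ones (13 - r)) D) []),
      passes r A D t = true ∧ x ∈ explore r (addRow (13 - r) A (t % 2 ^ 256) t)
        (addDeg (13 - r) D (t % 2 ^ 256)) [] := by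
  rw [explore_succ]
  induction candidates (collect A id 14 (unsaturated (ones (13 - r)) D) []) with
  | nil => simp
  | cons t l ihl =>
    dsimp only
    cases h : passes r A D t
    · rw [sel_false, ihl]
      simp only [List.mem_cons, exists_eq_or_imp, h, Bool.false_eq_true, false_and, false_or]
    · rw [sel_true, mem_explore, ihl, or_comm]
      simp only [List.mem_cons, exists_eq_or_imp, h, true_and]

theorem mem_candidates {U : List ℕ} : x ∈ candidates U ↔ (U = [] ∧ x = 0) ∨
    ∃ (p : ℕ) (U' L : List ℕ), U = p :: U' ∧ L.Sublist U' ∧ L.length ≤ 2 ∧ x = p + L.sum := by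
  cases U with
  | nil =>
    change x ∈ [0] ↔ _
    simp
  | cons p U =>
    change x ∈ subsums 2 U p [] ↔ _
    rw [mem_subsums]
    simp

/-- The list of the unsaturated vertices. -/
noncomputable def openList (G : SimpleGraph ℕ) (k : ℕ) : List ℕ :=
  (List.range k).filter fun v => (if (deg G k v + 1) &&& 4 = 0 then 1 else 0) = 1

theorem collect_degs (hk : k ≤ 14) : collect (mat G k) id 14 (unsaturated (ones k) (degs G k)) [] =
    (openList G k).map fun v => item (mat G k) (16 * v) := by
  rw [unsaturated_degs hk, collect_pack hk fun v _ => by split_ifs <;> simp]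
  simp [openList]

theorem sum_map_eq_sum_adj {l : List ℕ} (hl : l.Nodup) (h : ∀ j, j ∈ l ↔ j < k ∧ G.Adj i j)
    (f : ℕ → ℕ) : (l.map f).sum = ∑ j ∈ Finset.range k, adj G i j * f j := by
  classical
  have hs : l.toFinset = (Finset.range k).filter fun j => G.Adj i j := by
    ext j
    simp [h]
  rw [← List.sum_toFinset f hl, hs, Finset.sum_filter]
  refine Finset.sum_congr rfl fun j _ => ?_
  by_cases hj : G.Adj i j
  · rw [if_pos hj, adj_eq_one.2 hj, one_mul]
  · rw [if_neg hj, adj_eq_zero.2 hj, zero_mul]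

/-- The graph on the first `k` vertices and the vertex `k` with the neighbours in `l`. -/
def addVertex (G : SimpleGraph ℕ) (k : ℕ) (l : List ℕ) : SimpleGraph ℕ where
  Adj i j := (i < k ∧ j < k ∧ G.Adj i j) ∨ (i = k ∧ j < k ∧ j ∈ l) ∨ (j = k ∧ i < k ∧ i ∈ l)
  symm := ⟨fun i j h => by rw [G.adj_comm j i]; tauto⟩
  loopless := ⟨fun i h => by
    rcases h with ⟨-, -, h⟩ | ⟨rfl, h, -⟩ | ⟨rfl, h, -⟩
    · exact G.loopless.irrefl i h
    · exact lt_irrefl _ h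
    · exact lt_irrefl _ h⟩

theorem explore_zero : explore 0 A D [] = sel (accept A D) [A] [] := rfl

/-- Each candidate is a sum of items of distinct earlier vertices, hence the `itemSum` of a graph
`addVertex`. The pruning tests play no role, since `accept` decides at the end. Agreement on the old
vertices preserves the initial edge `01`. -/
theorem exists_of_mem_explore (hr : r ≤ 12) (hG : Labelled G)
    (h : x ∈ explore r (mat G (14 - r)) (degs G (14 - r)) []) :
    ∃ G', Labelled G' ∧ (∀ i < 14 - r, ∀ j < 14 - r, G'.Adj i j ↔ G.Adj i j) ∧
      x = mat G' 14 ∧ accept (mat G' 14) (degs G' 14) = true := by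
  induction r generalizing G with
  | zero =>
    rw [Nat.sub_zero, explore_zero] at h
    refine ⟨G, hG, fun _ _ _ _ => Iff.rfl, ?_⟩
    cases ha : accept (mat G 14) (degs G 14)
    · rw [ha, sel_false] at h
      exact absurd h List.not_mem_nil
    · rw [ha, sel_true, List.mem_singleton] at h
      exact ⟨h, rfl⟩
  | succ r ih =>
    obtain ⟨k, hk⟩ : ∃ k, k = 13 - r := ⟨_, rfl⟩
    rw [show 14 - (r + 1) = k by omega] at h ⊢
    obtain ⟨t, ht, -, hx⟩ := mem_explore_succ.1 h
    rw [← hk, collect_degs (by omega)] at ht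
    obtain ⟨l, hl, rfl⟩ : ∃ l : List ℕ, l.Sublist (openList G k) ∧
        t = (l.map fun v => item (mat G k) (16 * v)).sum := by
      have : ∃ L : List ℕ, L.Sublist ((openList G k).map fun v => item (mat G k) (16 * v)) ∧
          t = L.sum := by
        rcases mem_candidates.1 ht with ⟨-, rfl⟩ | ⟨p, U', L, hU, hL, -, rfl⟩
        · exact ⟨[], List.nil_sublist _, rfl⟩
        · exact ⟨p :: L, hU ▸ hL.cons_cons p, by simp⟩
      obtain ⟨L, hL, rfl⟩ := this
      obtain ⟨l, hl, rfl⟩ := List.sublist_map_iff.1 hL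
      exact ⟨l, hl, rfl⟩
    have hl' : l.Sublist (List.range k) := hl.trans List.filter_sublist
    have hlk : ∀ j ∈ l, j < k := fun j hj => List.mem_range.1 (hl'.subset hj)
    set G₁ := addVertex G k l with hG₁
    have hag : ∀ i < k, ∀ j < k, G₁.Adj i j ↔ G.Adj i j := fun i hi j hj => by
      simp only [hG₁, addVertex]
      have := hi.ne
      have := hj.ne
      tauto
    have hlab : Labelled G₁ := fun i j h => by
      rcases h with ⟨h, -, -⟩ | ⟨h, -, -⟩ | ⟨-, h, -⟩ <;> omega
    have hmem : ∀ j, j ∈ l ↔ j < k ∧ G₁.Adj k j := fun j => by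
      simp only [hG₁, addVertex, lt_self_iff_false, false_and, false_or, true_and, and_false,
        or_false]
      exact ⟨fun h => ⟨hlk j h, hlk j h, h⟩, fun h => h.2.2⟩
    have ht : (l.map fun v => item (mat G k) (16 * v)).sum = itemSum G₁ k := by
      rw [← mat_congr hag]
      exact sum_map_eq_sum_adj (hl'.nodup List.nodup_range) hmem _
    rw [ht, ← hk, ← mat_congr hag, ← degs_congr hag, addRow_mat (by omega), addDeg_degs (by omega),
      show k + 1 = 14 - r by omega] at hx
    obtain ⟨G', h₁, h₂, h₃⟩ := ih (by omega) hlab hx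
    refine ⟨G', h₁, fun i hi j hj => ?_, h₃⟩
    rw [h₂ i (by omega) j (by omega), hag i hi j hj]

theorem Good.deg_le_three (hG : Good G) (hk : k ≤ 14) (hi : i < 14) : deg G k i ≤ 3 :=
  (deg_mono hk).trans (hG.deg_eq i hi).le

theorem mem_openList (hG : Good G) (hk : k ≤ 14) : v ∈ openList G k ↔ v < k ∧ deg G k v < 3 := by
  simp only [openList, List.mem_filter, List.mem_range, decide_eq_true_eq]
  refine and_congr_right fun hv => ?_
  have := hG.deg_le_three hk (hv.trans_le hk)
  generalize deg G k v = d at *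
  interval_cases d <;> decide

/-- In a maximal graph, a new vertex is adjacent to the first unsaturated vertex. -/
theorem adj_first (hG : Good G) (hmax : Maximal G) (hk : 2 ≤ k) (hk' : k < 14) {p : ℕ} (hp : p < k)
    (hpk : deg G k p < 3) (hfirst : ∀ q < p, 3 ≤ deg G k q) : G.Adj k p := by
  obtain ⟨w, hkw, hw, hadj⟩ := exists_adj_of_deg_lt (hpk.trans_eq (hG.deg_eq p (by omega)).symm)
  rcases hkw.eq_or_lt with rfl | hkw
  · exact hadj.symm
  -- Otherwise exchange `k` with the later neighbour `w` of `p`. The vertices before `p` are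
  -- saturated, so neither `k` nor `w` is adjacent to them, and the bit of `p` makes the column at
  -- place `k` larger; earlier columns do not change.
  by_contra hc
  have hne : ∀ i, i ≠ k → i ≠ w → Equiv.swap k w i = i := fun i h h' =>
    Equiv.swap_apply_of_ne_of_ne h h'
  have hσ : Renaming (Equiv.swap k w) :=
    ⟨hne 0 (by omega) (by omega), hne 1 (by omega) (by omega),
      fun i hi => hne i (by omega) (by omega)⟩
  have hagree : ∀ i < k, Equiv.swap k w i = (1 : Equiv.Perm ℕ) i := fun i hi =>
    hne i (by omega) (by omega)
  have hzero : ∀ v, k ≤ v → v < 14 → sg G 1 p v = 0 := fun v hv hv' => sg_eq_zero fun q hq => by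
    refine adj_eq_zero.2 fun h => ?_
    have h₁ := deg_lt_deg (G := G) h hv hv'
    rw [hG.deg_eq _ (by simp; omega)] at h₁
    exact h₁.not_ge (hfirst q hq)
  have hlt : sg G 1 k k < sg G 1 k w := by
    refine sg_lt_sg (i := p + 1) (by omega) ?_
    rw [sg, sg, hzero k le_rfl hk', hzero w hkw.le hw]
    have h₁ : adj G p k = 0 := adj_eq_zero.2 fun h => hc h.symm
    have h₂ : adj G p w = 1 := adj_eq_one.2 hadj
    simp [h₁, h₂]
  refine (hmax _ hσ).not_gt ⟨k, fun i hi => ?_, ?_⟩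
  · change col G 1 i = col G (Equiv.swap k w) i
    rw [col, col, hagree i hi, sg_congr fun j hj => (hagree j (by omega))]
  · change col G 1 k < col G (Equiv.swap k w) k
    rw [col, col, sg_congr hagree, Equiv.swap_apply_left]
    exact hlt

/-- The earlier neighbours of `k` had degree below `3` before `k` came, they number at most `3`, and
by `adj_first` they include the first open vertex. That leaves at most two further choices. -/
theorem itemSum_mem_candidates (hG : Good G) (hmax : Maximal G) (hk : 2 ≤ k) (hk' : k < 14) :
    itemSum G k ∈ candidates ((openList G k).map fun v => item (mat G k) (16 * v)) := by
  classical
  set N := (List.range k).filter fun j => G.Adj k j with hN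
  have hmemN : ∀ j, j ∈ N ↔ j < k ∧ G.Adj k j := by simp [hN]
  have hnodup : N.Nodup := List.nodup_range.filter _
  have hsum : ∀ f : ℕ → ℕ, (N.map f).sum = ∑ j ∈ Finset.range k, adj G k j * f j :=
    sum_map_eq_sum_adj hnodup hmemN
  have hlen : N.length ≤ 3 := by
    have h := hsum fun _ => 1
    simp only [List.map_const', List.sum_replicate, smul_eq_mul, mul_one] at h
    rw [h]
    exact hG.deg_le_three hk'.le hk'
  have hsub : N.Sublist (openList G k) := by
    refine List.Sublist.trans (l₂ := N.filter fun v => v ∈ openList G k) ?_ ?_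
    · rw [List.filter_eq_self.2]
      intro j hj
      obtain ⟨hjk, hadj⟩ := (hmemN j).1 hj
      rw [decide_eq_true_eq, mem_openList hG hk'.le]
      exact ⟨hjk, (deg_lt_deg hadj.symm le_rfl hk').trans_eq (hG.deg_eq j (by omega))⟩
    · have : openList G k = (List.range k).filter fun v => v ∈ openList G k := by
        conv_lhs => unfold openList
        refine List.filter_congr fun v hv => ?_
        simp [openList, List.mem_range.1 hv]
      have h := (List.filter_sublist (p := fun j => decide (G.Adj k j)) (l := List.range k)).filter
        fun v => v ∈ openList G k
      rwa [← this] at h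
  have ht : itemSum G k = (N.map fun v => item (mat G k) (16 * v)).sum := (hsum _).symm
  have hsorted : (openList G k).Pairwise (· < ·) := List.pairwise_lt_range.filter _
  rw [ht, mem_candidates]
  cases hO : openList G k with
  | nil =>
    rw [hO, List.sublist_nil] at hsub
    simp [hsub]
  | cons p F =>
    right
    rw [hO] at hsub hsorted
    rw [List.pairwise_cons] at hsorted
    have hp : p < k ∧ deg G k p < 3 := by
      rw [← mem_openList hG hk'.le, hO]
      exact List.mem_cons_self
    have hpN : p ∈ N := by
      refine (hmemN p).2 ⟨hp.1, adj_first hG hmax hk hk' hp.1 hp.2 fun q hq => ?_⟩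
      by_contra hc
      have hq' : q ∈ openList G k :=
        (mem_openList hG hk'.le).2 ⟨by omega, not_le.1 hc⟩
      rw [hO, List.mem_cons] at hq'
      rcases hq' with rfl | hq'
      · exact lt_irrefl _ hq
      · exact (hsorted.1 q hq').not_gt hq
    rcases List.sublist_cons_iff.1 hsub with h | ⟨N', hN', h⟩
    · exact absurd (hsorted.1 p (h.subset hpN)) (lt_irrefl p)
    · refine ⟨_, _, N'.map fun v => item (mat G k) (16 * v), rfl, h.map _, ?_, ?_⟩
      · rw [hN', List.length_cons] at hlen
        rw [List.length_map]
        omega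
      · rw [hN', List.map_cons, List.sum_cons]

theorem admissible_itemSum (hG : Good G) (hk : 2 ≤ k) (hk' : k < 14) :
    admissible (ones k) (itemSum G k) (itemSum G k % 2 ^ 256) = true := by
  -- The value `65537` would mean adjacency to both `0` and `1`, a triangle on the edge `01`.
  have h₁ : pack 16 k (adj G k) % 2 ^ 32 ≠ 65537 := by
    obtain ⟨m, rfl⟩ := Nat.exists_eq_add_of_le hk
    have h₂ : pack 16 (2 + m) (adj G (2 + m)) % 2 ^ 32 =
        adj G (2 + m) 0 + adj G (2 + m) 1 * 2 ^ 16 := by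
      have h₃ : ∀ m f, pack 16 (2 + m) f = f 0 + f 1 * 2 ^ 16 +
          2 ^ 32 * pack 16 m fun v => f (2 + v) := by
        intro m f
        rw [pack, Finset.sum_range_add, Finset.sum_range_succ, Finset.sum_range_succ]
        simp only [Finset.range_zero, Finset.sum_empty, pack, Finset.mul_sum]
        norm_num
        refine Finset.sum_congr rfl fun v _ => ?_
        rw [mul_add, pow_add]
        ring
      have h₄ := adj_le_one (G := G) (i := 2 + m) (j := 0)
      have h₅ := adj_le_one (G := G) (i := 2 + m) (j := 1)
      rw [h₃, Nat.add_mul_mod_self_left, Nat.mod_eq_of_lt]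
      omega
    rw [h₂]
    intro h
    have h₄ := adj_le_one (G := G) (i := 2 + m) (j := 0)
    have h₅ := adj_le_one (G := G) (i := 2 + m) (j := 1)
    exact common_eq_zero.1 hG.common_eq (2 + m) hk'
      ⟨(adj_eq_one.1 (by omega : adj G (2 + m) 0 = 1)).symm,
        (adj_eq_one.1 (by omega : adj G (2 + m) 1 = 1)).symm⟩
  -- The counts are at most `3`, so bit 1 is set exactly when there are two or more common
  -- neighbours; it may be set only at neighbours of `k`, which `2 * adj` marks with the same bit.
  have h₂ : ((itemSum G k >>> 256) % 2 ^ 256 &&& (ones k * 2)) ||| 2 * (pack 16 k (adj G k)) =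
      2 * pack 16 k (adj G k) := by
    have hle : ∀ v, 2 * adj G k v < 2 ^ 16 := fun v =>
      (Nat.mul_le_mul_left 2 adj_le_one).trans_lt (by norm_num)
    rw [itemSum_shiftRight_mod hk'.le, ones_eq, pack_mul, mul_pack,
      pack_land (by norm_num) (fun _ _ => common_lt hk'.le) (fun _ _ => by norm_num),
      pack_lor (by norm_num) (fun _ _ => Nat.and_lt_two_pow _ (by norm_num)) fun v _ => hle v]
    refine pack_congr fun v hv => ?_
    have h₃ : common G k k v ≤ 3 := common_le_deg.trans (hG.deg_le_three hk'.le hk')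
    have h₄ : adj G k v = 0 → common G k k v ≤ 1 := fun h =>
      (common_mono hk'.le).trans
        (hG.common_le k hk' v (hv.trans hk') hv.ne' (adj_eq_zero.1 h))
    rcases adj_zero_or_one (G := G) (i := k) (j := v) with h | h
    · have := h₄ h
      rw [h]
      generalize common G k k v = c at *
      interval_cases c <;> rfl
    · rw [h]
      generalize common G k k v = c at *
      interval_cases c <;> rfl
  rw [itemSum_mod hk'.le]
  change sel (Nat.beq (pack 16 k (adj G k) % 2 ^ 32) 65537) false
    (Nat.beq (((itemSum G k >>> 256) % 2 ^ 256 &&& (ones k * 2)) ||| 2 * pack 16 k (adj G k))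
      (2 * pack 16 k (adj G k))) = true
  rw [h₂, (nat_beq_eq_false _ _).2 h₁, Nat.beq_refl]
  rfl

/-- Here `d ≤ 3` and `r < 3`, so `d + r + 1` is below `8` and its bit 2 expresses `d + r ≥ 3`. -/
theorem minDeg_degs (hG : Good G) (hr : r < 3) :
    minDeg (ones (14 - r)) (degs G (14 - r)) r = true := by
  change Nat.beq ((degs G (14 - r) + ones (14 - r) * (r + 1)) &&& (ones (14 - r) * 4))
    (ones (14 - r) * 4) = true
  have hd : ∀ v < 14 - r, 3 ≤ deg G (14 - r) v + r ∧ deg G (14 - r) v ≤ 3 := fun v hv => by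
    have h₁ := deg_add_le (G := G) (k := 14 - r) (m := r) (i := v)
    rw [show 14 - r + r = 14 by omega, hG.deg_eq v (by omega)] at h₁
    exact ⟨h₁, hG.deg_le_three (by omega) (by omega)⟩
  rw [nat_beq_eq_true, ones_eq, degs, pack_mul, pack_mul, pack_add, pack_land (by norm_num)]
  · refine pack_congr fun v hv => ?_
    obtain ⟨h₁, h₂⟩ := hd v hv
    generalize deg G (14 - r) v = d at *
    interval_cases r <;> interval_cases d <;> first | rfl | omega
  · intro v hv
    have := (hd v hv).2
    omega
  · intro v _
    norm_num

/-- Adding the vertices of a maximal good graph in their order is a path through the search: each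
initial part passes all the tests. -/
theorem mem_explore_of_maximal (hG : Good G) (hmax : Maximal G) (hr : r ≤ 12) :
    mat G 14 ∈ explore r (mat G (14 - r)) (degs G (14 - r)) [] := by
  induction r with
  | zero =>
    rw [Nat.sub_zero, explore_zero, accept_iff.2
      ⟨hG.deg_eq, hmax.isMax le_rfl (by norm_num), hG.common_eq, hG.common_le⟩,
      sel_true]
    exact List.mem_singleton_self _
  | succ r ih =>
    obtain ⟨k, hk⟩ : ∃ k, k = 13 - r := ⟨_, rfl⟩
    rw [show 14 - (r + 1) = k by omega, mem_explore_succ, ← hk, collect_degs (by omega)]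
    refine ⟨itemSum G k, itemSum_mem_candidates hG hmax (by omega) (by omega), ?_, ?_⟩
    · rw [passes, ← hk, addRow_mat (by omega), addDeg_degs (by omega),
        admissible_itemSum hG (by omega) (by omega), show k + 1 = 14 - r by omega,
        hmax.isMax (by omega) (by omega)]
      rcases lt_or_ge r 3 with h | h
      · rw [minDeg_degs hG h]
        cases Nat.ble 3 r <;> rfl
      · rw [(nat_ble_eq_true 3 r).2 h]
        rfl
    · rw [addRow_mat (by omega), addDeg_degs (by omega), show k + 1 = 14 - r by omega]
      exact ih (by omega)

theorem mem_canonicalList : x ∈ canonicalList ↔ ∃ G, Good G ∧ Maximal G ∧ x = mat G 14 := by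
  have hinit : ∀ G : SimpleGraph ℕ, G.Adj 0 1 →
      canonicalList = explore 12 (mat G (14 - 12)) (degs G (14 - 12)) [] := by
    intro G h
    have h₁ := adj_eq_one.2 h
    have h₂ := adj_eq_one.2 h.symm
    have h₃ : pack 16 2 (adj G 0) = Nat.pow 2 16 := by simp [pack, Finset.sum_range_succ, h₁]
    have h₄ : pack 16 2 (adj G 1) = 1 := by simp [pack, Finset.sum_range_succ, h₂]
    have h₅ : mat G (14 - 12) = Nat.add (Nat.pow 2 256) (Nat.pow 2 16) := by
      rw [show 14 - 12 = 2 from rfl, mat, pack_succ, pack_succ, pack_zero, h₃, h₄, mul_zero,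
        pow_zero, mul_one, mul_one, one_mul, zero_add, add_comm]
      rfl
    have h₆ : degs G (14 - 12) = 65537 := by
      rw [show 14 - 12 = 2 from rfl]
      simp [degs, deg, pack, Finset.sum_range_succ, h₁, h₂]
    rw [h₅, h₆]
    exact canonicalList.eq_1
  constructor
  · intro h
    -- Any graph containing `01` encodes the starting position; this one is also labelled, as
    -- soundness demands.
    have hadj : (SimpleGraph.edge 0 1 : SimpleGraph ℕ).Adj 0 1 := by simp [SimpleGraph.edge_adj]
    rw [hinit _ hadj] at h
    obtain ⟨G, h₃, h₄, h₅, h₆⟩ := exists_of_mem_explore le_rfl (fun i j h => by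
      rw [SimpleGraph.edge_adj] at h
      omega) h
    obtain ⟨h₇, h₈, h₉, h₁₀⟩ := accept_iff.1 h₆
    exact ⟨G, ⟨h₃, h₇, h₁₀, (h₄ 0 (by norm_num) 1 (by norm_num)).2 hadj, h₉⟩,
      maximal_of_isMax h₃ h₈, h₅⟩
  · intro ⟨G, hG, hmax, hx⟩
    rw [hx, hinit G hG.edge]
    exact mem_explore_of_maximal hG hmax le_rfl

/-! ### The classification of the canonical graphs -/

theorem noTriangle_mat (hi : i < 14) : noTriangle (mat G 14) (16 * i) = true ↔
    ∀ j < 14, G.Adj i j → common G 14 j i = 0 := by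
  unfold noTriangle
  rw [force_eq, row_mat le_rfl hi, allBits_pack le_rfl fun _ _ => adj_zero_or_one]
  refine forall₂_congr fun j hj => ?_
  rw [adj_eq_one, nat_beq_eq_true, nat_land_eq, ← row_mat le_rfl hi, row_land_row hj hi]
  refine forall_congr' fun _ => ?_
  rw [pack_eq_zero, common, Finset.sum_eq_zero_iff]
  simp only [Finset.mem_range]

end

/-- The number of members of a list with given answers to the triangle tests. -/
noncomputable def triangleCount (l : List ℕ) (p q : Bool) : ℕ :=
  (l.filter fun A => noTriangle A 0 = p ∧ noTriangle A 16 = q).length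

/-- Each key lies below its predecessor, so every later key is smaller and none repeats. -/
theorem tally_spec {n₁ n₂ n₃ n₄ : ℕ} (l : List ℕ) {x a b c d : ℕ}
    (h : tally n₁ n₂ n₃ n₄ l x a b c d = true) :
    ((∀ A ∈ l, key A < x) ∧ (l.map key).Nodup) ∧
      a + triangleCount l false false = n₁ ∧ b + triangleCount l false true = n₂ ∧
      c + triangleCount l true false = n₃ ∧ d + triangleCount l true true = n₄ := by
  induction l generalizing x a b c d with
  | nil =>
    change sel (Nat.beq a n₁) (sel (Nat.beq b n₂) (sel (Nat.beq c n₃)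
      (Nat.beq d n₄) false) false) false = true at h
    simpa [nat_beq_eq_true, triangleCount] using h
  | cons A l ih =>
    have hstep : tally n₁ n₂ n₃ n₄ (A :: l) x a b c d =
        sel (Nat.ble x (key A)) false (sel (noTriangle A 0)
          (sel (noTriangle A 16) (tally n₁ n₂ n₃ n₄ l (key A) a b c (d + 1))
            (tally n₁ n₂ n₃ n₄ l (key A) a b (c + 1) d))
          (sel (noTriangle A 16) (tally n₁ n₂ n₃ n₄ l (key A) a (b + 1) c d)
            (tally n₁ n₂ n₃ n₄ l (key A) (a + 1) b c d))) :=
      (show tally n₁ n₂ n₃ n₄ (A :: l) x a b c d = force (key A) fun y =>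
        sel (Nat.ble x y) false (sel (noTriangle A 0)
          (sel (noTriangle A 16) (tally n₁ n₂ n₃ n₄ l y a b c (d + 1))
            (tally n₁ n₂ n₃ n₄ l y a b (c + 1) d))
          (sel (noTriangle A 16) (tally n₁ n₂ n₃ n₄ l y a (b + 1) c d)
            (tally n₁ n₂ n₃ n₄ l y (a + 1) b c d))) from rfl).trans (force_eq _ _)
    rw [hstep] at h
    cases hx : Nat.ble x (key A)
    · rw [hx] at h
      have hx' := (nat_ble_eq_false _ _).1 hx
      have key : ∀ {a' b' c' d'}, tally n₁ n₂ n₃ n₄ l (key A) a' b' c' d' = true →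
          ((∀ B ∈ A :: l, SegmentCount.key B < x) ∧ ((A :: l).map SegmentCount.key).Nodup) ∧
          a' + triangleCount l false false = n₁ ∧ b' + triangleCount l false true = n₂ ∧
          c' + triangleCount l true false = n₃ ∧ d' + triangleCount l true true = n₄ := by
        intro a' b' c' d' h
        obtain ⟨⟨h₁, h₂⟩, h₃⟩ := ih h
        refine ⟨⟨?_, ?_⟩, h₃⟩
        · intro B hB
          rcases List.mem_cons.1 hB with rfl | hB
          · exact hx'
          · exact (h₁ B hB).trans hx'
        · rw [List.map_cons, List.nodup_cons]
          refine ⟨fun hmem => ?_, h₂⟩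
          obtain ⟨B, hB, hB'⟩ := List.mem_map.1 hmem
          exact (h₁ B hB).ne hB'
      cases h₀ : noTriangle A 0 <;> cases h₁ : noTriangle A 16 <;> rw [h₀, h₁] at h <;>
        obtain ⟨h₂, h₃, h₄, h₅, h₆⟩ := key h <;> refine ⟨h₂, ?_⟩ <;>
        simp only [triangleCount, List.filter_cons, h₀, h₁] at h₃ h₄ h₅ h₆ ⊢ <;>
        simp at h₃ h₄ h₅ h₆ ⊢ <;> omega
    · rw [hx] at h
      exact absurd h Bool.false_ne_true

theorem canonicalList_spec : canonicalList.Nodup ∧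
    triangleCount canonicalList false false = 19 ∧ triangleCount canonicalList false true = 78 ∧
    triangleCount canonicalList true false = 78 ∧ triangleCount canonicalList true true = 303 := by
  obtain ⟨⟨-, h₁⟩, h₂, h₃, h₄, h₅⟩ := tally_spec _ tally_canonicalList
  exact ⟨h₁.of_map, by omega, by omega, by omega, by omega⟩

/-! ### From good cubic graphs to labelled graphs -/

section

variable {W W' : Type} {H : SimpleGraph W} {H' : SimpleGraph W'}

theorem isGoodCubic_of_iso (e : H ≃g H') (hH : IsGoodCubic H) : IsGoodCubic H' := by
  have h₁ : ∀ v, H'.neighborSet (e v) = e '' H.neighborSet v := fun v => by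
    ext w
    obtain ⟨w, rfl⟩ := e.surjective w
    rw [e.injective.mem_set_image]
    exact e.map_adj_iff
  have h₂ : ∀ u v, H'.commonNeighbors (e u) (e v) = e '' H.commonNeighbors u v := fun u v => by
    rw [SimpleGraph.commonNeighbors, h₁, h₁, ← Set.image_inter e.injective]
    rfl
  refine ⟨(Nat.card_congr e.toEquiv).symm.trans hH.order, fun v => ?_, fun u v huv hadj => ?_⟩
  · obtain ⟨v, rfl⟩ := e.surjective v
    rw [h₁, Set.ncard_image_of_injective _ e.injective, hH.cubic]
  · obtain ⟨u, rfl⟩ := e.surjective u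
    obtain ⟨v, rfl⟩ := e.surjective v
    rw [h₂, Set.ncard_image_of_injective _ e.injective]
    exact hH.common u v (ne_of_apply_ne e huv) fun h => hadj (e.map_adj_iff.2 h)

theorem ofEdge_iso (e : H ≃g H') (y z : W) :
    (HandledGraph.ofEdge H y z).Iso (HandledGraph.ofEdge H' (e y) (e z)) := by
  let f : {w : W // w ≠ y ∧ w ≠ z} ≃ {w : W' // w ≠ e y ∧ w ≠ e z} :=
    e.toEquiv.subtypeEquiv fun w => by
      change _ ↔ e w ≠ e y ∧ e w ≠ e z
      rw [e.injective.ne_iff, e.injective.ne_iff]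
  refine ⟨⟨f, e.map_adj_iff⟩, ?_, ?_⟩
  · ext w
    obtain ⟨w, rfl⟩ := f.surjective w
    exact (f.injective.mem_set_image).trans e.map_adj_iff.symm
  · ext w
    obtain ⟨w, rfl⟩ := f.surjective w
    exact (f.injective.mem_set_image).trans e.map_adj_iff.symm

/-! ### Handles and their kinds. -/

theorem handleKind_holds_of_iso {k : HandleKind} {Y : Set W} (e : H ≃g H') (h : k.Holds H Y) :
    k.Holds H' (e '' Y) := by
  cases k <;> obtain ⟨a, b, hab, rfl, h⟩ := h <;>
    exact ⟨e a, e b, e.injective.ne hab, Set.image_pair e a b, by rwa [e.map_adj_iff]⟩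

theorem hasType_of_iso {S T : HandledGraph} {t : HandleKind × HandleKind} (h : S.Iso T)
    (hS : S.HasType t) : T.HasType t := by
  obtain ⟨e, h₁, h₂⟩ := h
  exact ⟨h₁ ▸ handleKind_holds_of_iso e hS.1, h₂ ▸ handleKind_holds_of_iso e hS.2⟩

theorem holds_edge_iff {Y : Set W} (hY : Y.ncard = 2) :
    HandleKind.edge.Holds H Y ↔ ∃ a ∈ Y, ∃ b ∈ Y, H.Adj a b := by
  constructor
  · rintro ⟨a, b, -, rfl, h⟩
    exact ⟨a, by simp, b, by simp, h⟩
  · obtain ⟨a, b, hab, rfl⟩ := Set.ncard_eq_two.1 hY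
    rintro ⟨c, hc, d, hd, h⟩
    refine ⟨a, b, hab, rfl, ?_⟩
    rcases hc with rfl | rfl <;> rcases hd with rfl | rfl
    exacts [(H.irrefl h).elim, h, h.symm, (H.irrefl h).elim]

theorem holds_nonEdge_iff {Y : Set W} (hY : Y.ncard = 2) :
    HandleKind.nonEdge.Holds H Y ↔ ¬ ∃ a ∈ Y, ∃ b ∈ Y, H.Adj a b := by
  rw [← holds_edge_iff hY]
  constructor
  · rintro ⟨a, b, hab, rfl, h⟩ ⟨c, d, hcd, hY', h'⟩
    have ha : a = c ∨ a = d := by simpa using (Set.ext_iff.1 hY' a).1 (by simp)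
    have hb : b = c ∨ b = d := by simpa using (Set.ext_iff.1 hY' b).1 (by simp)
    rcases ha with rfl | rfl <;> rcases hb with rfl | rfl
    exacts [hab rfl, h h', h h'.symm, hab rfl]
  · obtain ⟨a, b, hab, rfl⟩ := Set.ncard_eq_two.1 hY
    exact fun h => ⟨a, b, hab, rfl, fun h' => h ⟨a, b, hab, rfl, h'⟩⟩

variable {y z : W} {p : W → Prop}

/-- The predicate `p` is constrained only on neighbours of `y`, so that the lemma serves both ends
of the deleted edge. -/
theorem ncard_handle (hp : ∀ w, H.Adj y w → (p w ↔ w ≠ z)) (hyz : H.Adj y z)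
    (hy : (H.neighborSet y).ncard = 3) : {w : {w // p w} | H.Adj y w}.ncard = 2 := by
  rw [← Set.ncard_image_of_injective _ Subtype.val_injective]
  have h : Subtype.val '' {w : {w // p w} | H.Adj y w} = H.neighborSet y \ {z} := by
    ext w
    constructor
    · rintro ⟨w, hw, rfl⟩
      exact ⟨hw, (hp _ hw).1 w.2⟩
    · rintro ⟨hw, hw'⟩
      exact ⟨⟨w, (hp w hw).2 hw'⟩, hw, rfl⟩
  rw [h, Set.ncard_sdiff_singleton_of_mem (show z ∈ H.neighborSet y from hyz), hy]

/-- An edge between two neighbours of `y` cannot involve `z`, as `yz` lies in no triangle. So a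
triangle at `y` is the same as an edge in the handle. -/
theorem exists_adj_handle_iff (hp : ∀ w, H.Adj y w → (p w ↔ w ≠ z))
    (hyz : ∀ w, ¬ (H.Adj y w ∧ H.Adj z w)) :
    (∃ a ∈ {w : {w // p w} | H.Adj y w}, ∃ b ∈ {w : {w // p w} | H.Adj y w},
      (H.comap Subtype.val).Adj a b) ↔ ∃ a b, H.Adj y a ∧ H.Adj y b ∧ H.Adj a b := by
  constructor
  · rintro ⟨a, ha, b, hb, h⟩
    exact ⟨a, b, ha, hb, h⟩
  · rintro ⟨a, b, ha, hb, h⟩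
    refine ⟨⟨a, (hp a ha).2 ?_⟩, ha, ⟨b, (hp b hb).2 ?_⟩, hb, h⟩
    · rintro rfl
      exact hyz b ⟨hb, h⟩
    · rintro rfl
      exact hyz a ⟨ha, h.symm⟩

end

/-- A labelled graph as a graph on `14` vertices. -/
def toFin (G : SimpleGraph ℕ) : SimpleGraph (Fin 14) := G.comap Fin.val

/-- The segment of a labelled graph and its edge `01`. -/
def seg (G : SimpleGraph ℕ) : HandledGraph := HandledGraph.ofEdge (toFin G) 0 1

section

variable {G G' : SimpleGraph ℕ}

theorem ncard_neighborSet_toFin (i : Fin 14) :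
    ((toFin G).neighborSet i).ncard = deg G 14 i := by
  classical
  rw [deg, Finset.sum_range, Set.ncard_eq_toFinset_card', Finset.card_eq_sum_ones,
    ← Finset.sum_filter_add_sum_filter_not Finset.univ (fun j : Fin 14 => G.Adj i j)]
  rw [Finset.sum_congr (s₁ := Finset.univ.filter fun j : Fin 14 => ¬ G.Adj i j) rfl
    fun j hj => adj_eq_zero.2 (Finset.mem_filter.1 hj).2, Finset.sum_const_zero, add_zero]
  refine Finset.sum_congr ?_ fun j hj => (adj_eq_one.2 (Finset.mem_filter.1 hj).2).symm
  ext j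
  rw [Set.mem_toFinset, Finset.mem_filter_univ]
  rfl

theorem ncard_commonNeighbors_toFin (i j : Fin 14) :
    ((toFin G).commonNeighbors i j).ncard = common G 14 i j := by
  classical
  rw [common, Finset.sum_range, Set.ncard_eq_toFinset_card', Finset.card_eq_sum_ones,
    ← Finset.sum_filter_add_sum_filter_not Finset.univ
      (fun w : Fin 14 => G.Adj i w ∧ G.Adj j w)]
  rw [Finset.sum_congr (s₁ := Finset.univ.filter fun w : Fin 14 => ¬ (G.Adj i w ∧ G.Adj j w)) rfl
    fun w hw => ?_, Finset.sum_const_zero, add_zero]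
  · refine Finset.sum_congr ?_ fun w hw => ?_
    · ext w
      rw [Set.mem_toFinset, Finset.mem_filter_univ]
      rfl
    · have := (Finset.mem_filter.1 hw).2
      rw [adj_eq_one.2 this.1, adj_eq_one.2 this.2]
  · rw [mul_eq_zero, adj_eq_zero, adj_eq_zero, ← not_and_or]
    exact (Finset.mem_filter.1 hw).2

theorem Good.isGoodCubic (hG : Good G) : IsGoodCubic (toFin G) where
  order := by simp
  cubic v := (ncard_neighborSet_toFin v).trans (hG.deg_eq v v.2)
  common u v huv h := (ncard_commonNeighbors_toFin u v).trans_le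
    (hG.common_le u u.2 v v.2 (Fin.val_injective.ne huv) h)

theorem Good.not_common (hG : Good G) (w : Fin 14) :
    ¬ ((toFin G).Adj 0 w ∧ (toFin G).Adj 1 w) :=
  common_eq_zero.1 hG.common_eq w w.2

theorem good_of_isGoodCubic (hG : Labelled G) (h : IsGoodCubic (toFin G))
    (h₀ : (toFin G).Adj 0 1) (h₁ : ∀ w, ¬ ((toFin G).Adj 0 w ∧ (toFin G).Adj 1 w)) : Good G where
  labelled := hG
  deg_eq i hi := (ncard_neighborSet_toFin ⟨i, hi⟩).symm.trans (h.cubic ⟨i, hi⟩)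
  common_le i hi j hj hij hadj := (ncard_commonNeighbors_toFin ⟨i, hi⟩ ⟨j, hj⟩).symm.trans_le
    (h.common _ _ (fun h => hij (Fin.mk.inj h)) hadj)
  edge := h₀
  common_eq := common_eq_zero.2 fun w hw => h₁ ⟨w, hw⟩

theorem Good.isSegment (hG : Good G) : (seg G).IsSegment :=
  ⟨Fin 14, toFin G, 0, 1, hG.isGoodCubic, hG.edge, hG.not_common, HandledGraph.Iso.refl _⟩

/-! ### Existence and uniqueness of the maximal labelling. -/

theorem Renaming.inv {σ : Equiv.Perm ℕ} (h : Renaming σ) : Renaming σ⁻¹ where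
  zero := by rw [Equiv.Perm.inv_eq_iff_eq, h.zero]
  one := by rw [Equiv.Perm.inv_eq_iff_eq, h.one]
  large i hi := by rw [Equiv.Perm.inv_eq_iff_eq, h.large i hi]

/-- There are finitely many labellings with `y ↦ 0` and `z ↦ 1`; one with the largest columns gives
a maximal graph, because a renaming leads to another such labelling. -/
theorem exists_maximal {S : HandledGraph} (hS : S.IsSegment) :
    ∃ G, Good G ∧ Maximal G ∧ S.Iso (seg G) := by
  obtain ⟨W, H, y, z, hH, hyz, hcommon, hiso⟩ := hS
  have hW : Finite W := Nat.finite_of_card_ne_zero (by rw [hH.order]; norm_num)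
  let A : Set (W → ℕ) := {f | Function.Injective f ∧ (∀ w, f w < 14) ∧ f y = 0 ∧ f z = 1}
  have hA : A.Finite := (Set.Finite.pi' fun _ : W => Set.finite_Iio 14).subset fun f hf => hf.2.1
  have hne : A.Nonempty := by
    obtain ⟨e⟩ := (Finite.card_eq (α := W) (β := Fin 14)).1 (by rw [hH.order, Nat.card_fin])
    let e₁ := e.trans (Equiv.swap (e y) 0)
    have h₁ : e₁ y = 0 := by simp [e₁]
    let e₂ := e₁.trans (Equiv.swap (e₁ z) 1)
    have h₂ : e₂ z = 1 := by simp [e₂]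
    have h₃ : e₂ y = 0 := by
      -- The second transposition must not move `0`, the label already given to `y`.
      have h₄ : e₁ z ≠ 0 := fun h => hyz.ne (e₁.injective (h₁.trans h.symm))
      simp only [e₂, Equiv.trans_apply, h₁]
      exact Equiv.swap_apply_of_ne_of_ne h₄.symm (by decide)
    refine ⟨fun w => e₂ w, Fin.val_injective.comp e₂.injective, fun w => (e₂ w).2, ?_, ?_⟩
    · change (e₂ y : ℕ) = 0
      rw [h₃]
      rfl
    · change (e₂ z : ℕ) = 1
      rw [h₂]
      rfl
  let gr : (W → ℕ) → SimpleGraph ℕ := fun f =>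
    SimpleGraph.fromRel fun i j => ∃ a b, H.Adj a b ∧ f a = i ∧ f b = j
  have hgr : ∀ f ∈ A, ∀ i j, (gr f).Adj i j ↔ ∃ a b, H.Adj a b ∧ f a = i ∧ f b = j := by
    intro f hf i j
    rw [SimpleGraph.fromRel_adj]
    constructor
    · rintro ⟨-, h | ⟨a, b, h, h₁, h₂⟩⟩
      · exact h
      · exact ⟨b, a, h.symm, h₂, h₁⟩
    · rintro ⟨a, b, h, rfl, rfl⟩
      exact ⟨hf.1.ne h.ne, .inl ⟨a, b, h, rfl, rfl⟩⟩
  obtain ⟨f, hf, hmax⟩ := Set.exists_max_image A (fun f => toLex (col (gr f) 1)) hA hne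
  have hlab : Labelled (gr f) := by
    intro i j h
    obtain ⟨a, -, -, rfl, -⟩ := (hgr f hf i j).1 h
    exact hf.2.1 a
  have hbij : Function.Bijective fun w => (⟨f w, hf.2.1 w⟩ : Fin 14) :=
    Function.Injective.bijective_of_nat_card_le (fun a b h => hf.1 (Fin.mk.inj h))
      (by rw [hH.order, Nat.card_fin])
  let e : H ≃g toFin (gr f) := ⟨Equiv.ofBijective _ hbij, fun {a b} => by
    refine (hgr f hf (f a) (f b)).trans ⟨?_, fun h => ⟨a, b, h, rfl, rfl⟩⟩
    rintro ⟨c, d, h, h₁, h₂⟩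
    rwa [← hf.1 h₁, ← hf.1 h₂]⟩
  have h₀ : e y = 0 := Fin.ext hf.2.2.1
  have h₁ : e z = 1 := Fin.ext hf.2.2.2
  refine ⟨gr f, good_of_isGoodCubic hlab (isGoodCubic_of_iso e hH) ?_ fun w => ?_, ?_, ?_⟩
  · rw [← h₀, ← h₁]
    exact e.map_adj_iff.2 hyz
  · obtain ⟨w, rfl⟩ := e.surjective w
    rw [← h₀, ← h₁, e.map_adj_iff, e.map_adj_iff]
    exact hcommon w
  · intro σ hσ
    -- Relabelling the graph by `σ` corresponds to composing the labelling with the inverse of `σ`.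
    have hf' : ⇑σ⁻¹ ∘ f ∈ A := by
      refine ⟨σ⁻¹.injective.comp hf.1, fun w => hσ.inv.lt (hf.2.1 w), ?_, ?_⟩
      · rw [Function.comp_apply, hf.2.2.1, hσ.inv.zero]
      · rw [Function.comp_apply, hf.2.2.2, hσ.inv.one]
    have h : (gr f).comap σ = gr (⇑σ⁻¹ ∘ f) := by
      ext i j
      rw [hgr _ hf', SimpleGraph.comap_adj, hgr f hf]
      simp only [Function.comp_apply, Equiv.Perm.inv_eq_iff_eq]
    have h' : col (gr f) σ = col (gr (⇑σ⁻¹ ∘ f)) 1 := by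
      rw [← h]
      exact funext fun _ => col_comap.symm
    rw [h']
    exact hmax _ hf'
  · have h := ofEdge_iso e y z
    rw [h₀, h₁] at h
    exact hiso.trans h

/-- The vertices outside the edge `01` as natural numbers. -/
def innerEquiv : {w : Fin 14 // w ≠ 0 ∧ w ≠ 1} ≃ {i : ℕ // 2 ≤ i ∧ i < 14} where
  toFun w := ⟨w.1, by
    obtain ⟨w, h₀, h₁⟩ := w
    have h₂ : (w : ℕ) ≠ 0 := fun h => h₀ (Fin.ext h)
    have h₃ : (w : ℕ) ≠ 1 := fun h => h₁ (Fin.ext h)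
    have := w.2
    change 2 ≤ (w : ℕ) ∧ (w : ℕ) < 14
    omega⟩
  invFun i := ⟨⟨i, i.2.2⟩, fun h => by have := i.2.1; have := congrArg Fin.val h; simp at this; omega,
    fun h => by have := i.2.1; have := congrArg Fin.val h; simp at this; omega⟩
  left_inv _ := rfl
  right_inv _ := rfl

/-- Extend the isomorphism by fixing `0` and `1`. Preserving each handle is precisely preserving the
adjacencies to these two vertices. -/
theorem exists_renaming_of_iso (hG : Good G) (hG' : Good G') (h : (seg G).Iso (seg G')) :
    ∃ σ, Renaming σ ∧ G'.comap σ = G := by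
  obtain ⟨e, h₀, h₁⟩ := h
  let e' : Equiv.Perm {w : Fin 14 // w ≠ 0 ∧ w ≠ 1} := e.toEquiv
  have he : ∀ a b : {w : Fin 14 // w ≠ 0 ∧ w ≠ 1},
      G'.Adj (e' a).1 (e' b).1 ↔ G.Adj a.1 b.1 := fun a b => e.map_adj_iff
  have he₀ : ∀ a : {w : Fin 14 // w ≠ 0 ∧ w ≠ 1}, G'.Adj 0 (e' a).1 ↔ G.Adj 0 a.1 := fun a =>
    (Set.ext_iff.1 h₀ (e a)).symm.trans e.injective.mem_set_image
  have he₁ : ∀ a : {w : Fin 14 // w ≠ 0 ∧ w ≠ 1}, G'.Adj 1 (e' a).1 ↔ G.Adj 1 a.1 := fun a =>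
    (Set.ext_iff.1 h₁ (e a)).symm.trans e.injective.mem_set_image
  let σ : Equiv.Perm ℕ := e'.extendDomain innerEquiv
  have hout : ∀ i, ¬ (2 ≤ i ∧ i < 14) → σ i = i := fun i hi =>
    Equiv.Perm.extendDomain_apply_not_subtype _ _ hi
  have hin : ∀ a : {w : Fin 14 // w ≠ 0 ∧ w ≠ 1}, σ a.1 = (e' a).1 := fun a =>
    Equiv.Perm.extendDomain_apply_image e' innerEquiv a
  have hmid : ∀ i : ℕ, 2 ≤ i → i < 14 → ∃ a : {w : Fin 14 // w ≠ 0 ∧ w ≠ 1}, i = a.1 := fun i h h' =>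
    ⟨innerEquiv.symm ⟨i, h, h'⟩, rfl⟩
  have hσ : Renaming σ := ⟨hout 0 (by omega), hout 1 (by omega), fun i hi => hout i (by omega)⟩
  have hlarge : ∀ i j, 14 ≤ i → (G'.Adj (σ i) (σ j) ↔ G.Adj i j) := fun i j hi => by
    rw [hσ.large i hi]
    exact iff_of_false (fun h => (hG'.labelled _ _ h).not_ge hi)
      fun h => (hG.labelled _ _ h).not_ge hi
  have hcases : ∀ i, i = 0 ∨ i = 1 ∨ (2 ≤ i ∧ i < 14) ∨ 14 ≤ i := fun i => by omega
  have hzero : ∀ j, G'.Adj (σ 0) (σ j) ↔ G.Adj 0 j := fun j => by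
    rcases hcases j with rfl | rfl | ⟨h, h'⟩ | h
    · simp
    · rw [hσ.zero, hσ.one]
      exact iff_of_true hG'.edge hG.edge
    · obtain ⟨a, rfl⟩ := hmid j h h'
      rw [hσ.zero, hin]
      exact he₀ a
    · rw [G'.adj_comm, G.adj_comm, hlarge _ _ h]
  have hone : ∀ j, G'.Adj (σ 1) (σ j) ↔ G.Adj 1 j := fun j => by
    rcases hcases j with rfl | rfl | ⟨h, h'⟩ | h
    · rw [G'.adj_comm, G.adj_comm, hzero]
    · simp
    · obtain ⟨a, rfl⟩ := hmid j h h'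
      rw [hσ.one, hin]
      exact he₁ a
    · rw [G'.adj_comm, G.adj_comm, hlarge _ _ h]
  refine ⟨σ, hσ, ?_⟩
  ext i j
  change G'.Adj (σ i) (σ j) ↔ G.Adj i j
  rcases hcases i with rfl | rfl | ⟨h, h'⟩ | h
  · exact hzero j
  · exact hone j
  · rcases hcases j with rfl | rfl | ⟨k, k'⟩ | k
    · rw [G'.adj_comm, G.adj_comm, hzero]
    · rw [G'.adj_comm, G.adj_comm, hone]
    · obtain ⟨a, rfl⟩ := hmid i h h'
      obtain ⟨b, rfl⟩ := hmid j k k'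
      rw [hin, hin]
      exact he a b
    · rw [G'.adj_comm, G.adj_comm, hlarge _ _ k]
  · exact hlarge i j h

theorem col_le_of_iso (hG : Good G) (hG' : Good G') (hmax : Maximal G')
    (h : (seg G).Iso (seg G')) : toLex (col G 1) ≤ toLex (col G' 1) := by
  obtain ⟨σ, hσ, rfl⟩ := exists_renaming_of_iso hG hG' h
  rw [show col (G'.comap σ) 1 = col G' σ from funext fun _ => col_comap]
  exact hmax σ hσ

/-- Each graph is a renaming of the other, so by maximality their columns bound each other and
coincide. -/
theorem eq_of_iso (hG : Good G) (hG' : Good G') (hmax : Maximal G) (hmax' : Maximal G')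
    (h : (seg G).Iso (seg G')) : G = G' :=
  eq_of_col_eq <| congrFun <| toLex.injective <|
    (col_le_of_iso hG hG' hmax' h).antisymm (col_le_of_iso hG' hG hmax h.symm)

/-- The kind of a handle, given the answer to the triangle test. -/
def kind : Bool → HandleKind
  | false => .edge
  | true => .nonEdge

/-! ### The type of the segment of a labelled graph. -/

theorem noTriangle_iff (i : Fin 14) {n : ℕ} (hn : n = 16 * i) : noTriangle (mat G 14) n = true ↔
    ¬ ∃ a b, (toFin G).Adj i a ∧ (toFin G).Adj i b ∧ (toFin G).Adj a b := by
  rw [hn, noTriangle_mat i.2]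
  simp only [common_eq_zero]
  constructor
  · rintro h ⟨a, b, ha, hb, hab⟩
    exact h a a.2 ha b b.2 ⟨hab, hb⟩
  · exact fun h a ha hia b hb hab => h ⟨⟨a, ha⟩, ⟨b, hb⟩, hia, hab.2, hab.1⟩

theorem holds_iff {W : Type} {H : SimpleGraph W} {Y : Set W} (hY : Y.ncard = 2) {b : Bool}
    (hb : b = true ↔ ¬ ∃ x ∈ Y, ∃ y ∈ Y, H.Adj x y) (k : HandleKind) :
    k.Holds H Y ↔ k = kind b := by
  cases k
  · rw [holds_edge_iff hY, ← not_iff_not, ← hb]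
    cases b <;> simp [kind]
  · rw [holds_nonEdge_iff hY, ← hb]
    cases b <;> simp [kind]

theorem hasType_seg (hG : Good G) (t : HandleKind × HandleKind) : (seg G).HasType t ↔
    t = (kind (noTriangle (mat G 14) 0), kind (noTriangle (mat G 14) 16)) := by
  have h₀ : ∀ w, (toFin G).Adj 0 w → ((w ≠ 0 ∧ w ≠ 1) ↔ w ≠ 1) := fun w hw =>
    and_iff_right hw.ne'
  have h₁ : ∀ w, (toFin G).Adj 1 w → ((w ≠ 0 ∧ w ≠ 1) ↔ w ≠ 0) := fun w hw =>
    and_iff_left hw.ne'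
  have h₂ := noTriangle_iff (G := G) 0 (n := 0) rfl
  have h₃ := noTriangle_iff (G := G) 1 (n := 16) rfl
  generalize noTriangle (mat G 14) 0 = p at *
  generalize noTriangle (mat G 14) 16 = q at *
  rw [Prod.ext_iff]
  refine and_congr (holds_iff ?_ ?_ _) (holds_iff ?_ ?_ _)
  · exact ncard_handle h₀ hG.edge (hG.isGoodCubic.cubic 0)
  · exact h₂.trans (not_congr (exists_adj_handle_iff h₀ hG.not_common).symm)
  · exact ncard_handle h₁ hG.edge.symm (hG.isGoodCubic.cubic 1)
  · exact h₃.trans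
      (not_congr (exists_adj_handle_iff h₁ fun w hw => hG.not_common w hw.symm).symm)

end

/-! ### Counting isomorphism classes -/

/-- Sending a listed matrix to the class of its segment is a bijection: injective by uniqueness of
the maximal labelling, surjective by its existence. Invariance of `Q` lets it be tested by `p` on
the representative. -/
theorem isoClassCount_eq {Q : HandledGraph → Prop} (hQ : ∀ S T, S.Iso T → Q S → Q T)
    {p : ℕ → Bool} (hp : ∀ G, Good G → (Q (seg G) ↔ p (mat G 14) = true)) :
    HandledGraph.isoClassCount (fun S => S.IsSegment ∧ Q S) =
      (canonicalList.filter p).length := by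
  have hnodup : (canonicalList.filter p).Nodup := canonicalList_spec.1.filter p
  have hmem : ∀ x, x ∈ (canonicalList.filter p).toFinset ↔
      ∃ G, Good G ∧ Maximal G ∧ Q (seg G) ∧ x = mat G 14 := by
    intro x
    rw [List.mem_toFinset, List.mem_filter, mem_canonicalList]
    constructor
    · intro ⟨⟨G, hG, hmax, h⟩, hx⟩
      rw [h] at hx
      exact ⟨G, hG, hmax, (hp G hG).2 hx, h⟩
    · intro ⟨G, hG, hmax, hQG, h⟩
      rw [h]
      exact ⟨⟨G, hG, hmax, rfl⟩, (hp G hG).1 hQG⟩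
  rw [← List.toFinset_card_of_nodup hnodup]
  generalize (canonicalList.filter p).toFinset = s at hmem
  have hex := fun x : s => (hmem x).1 x.2
  choose g hgood hmax hQg hg using hex
  rw [← Fintype.card_coe, ← Nat.card_eq_fintype_card]
  symm
  refine Nat.card_eq_of_bijective (fun x => Quotient.mk _ ⟨seg (g x), (hgood x).isSegment, hQg x⟩)
    ⟨fun x y hxy => ?_, fun c => ?_⟩
  · have h : g x = g y := eq_of_iso (hgood x) (hgood y) (hmax x) (hmax y) (Quotient.exact hxy)
    exact Subtype.ext ((hg x).trans ((congrArg (mat · 14) h).trans (hg y).symm))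
  · obtain ⟨⟨S, hS, hQS⟩, rfl⟩ := Quotient.exists_rep c
    obtain ⟨G, hG, hmaxG, hiso⟩ := exists_maximal hS
    obtain ⟨x, hx⟩ : ∃ x : s, x.1 = mat G 14 :=
      ⟨⟨_, (hmem _).2 ⟨G, hG, hmaxG, hQ _ _ hiso hQS, rfl⟩⟩, rfl⟩
    refine ⟨x, Quotient.sound ?_⟩
    have h : g x = G :=
      mat_injective (hgood x).labelled hG.labelled ((hg x).symm.trans hx)
    change (seg (g x)).Iso S
    rw [h]
    exact hiso.symm

theorem kind_inj {p q : Bool} : kind p = kind q ↔ p = q := by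
  cases p <;> cases q <;> simp [kind]

theorem isoClassCount_hasType (p q : Bool) :
    HandledGraph.isoClassCount (fun S => S.IsSegment ∧ S.HasType (kind p, kind q)) =
      triangleCount canonicalList p q := by
  refine isoClassCount_eq (fun _ _ => hasType_of_iso) fun G hG => ?_
  rw [hasType_seg hG, Prod.mk_inj, kind_inj, kind_inj, decide_eq_true_eq, eq_comm,
    eq_comm (a := q)]

theorem length_eq_sum_triangleCount (l : List ℕ) : l.length =
    triangleCount l false false + triangleCount l false true + triangleCount l true false +
      triangleCount l true true := by
  induction l with
  | nil => rfl
  | cons A l ih =>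
    rw [List.length_cons, ih]
    simp only [triangleCount, List.filter_cons]
    generalize noTriangle A 0 = p
    generalize noTriangle A 16 = q
    cases p <;> cases q <;> simp <;> omega

theorem isoClassCount_isSegment :
    HandledGraph.isoClassCount HandledGraph.IsSegment = canonicalList.length := by
  have h := isoClassCount_eq (Q := fun _ => True) (p := fun _ => true)
    (fun _ _ _ => id) fun _ _ => iff_of_true trivial rfl
  simpa only [and_true, List.filter_true] using h

theorem existsUnique_hasType {S : HandledGraph} (hS : S.IsSegment) :
    ∃! t : HandleKind × HandleKind, S.HasType t := by
  obtain ⟨G, hG, -, hiso⟩ := exists_maximal hS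
  exact ⟨_, hasType_of_iso hiso.symm ((hasType_seg hG _).2 rfl), fun t ht =>
    (hasType_seg hG t).1 (hasType_of_iso hiso ht)⟩

end SegmentCount

theorem mainTheorem5 :
    HandledGraph.isoClassCount HandledGraph.IsSegment = 478 ∧
    (∀ S : HandledGraph, S.IsSegment → ∃! t : HandleKind × HandleKind, S.HasType t) ∧
    HandledGraph.isoClassCount (fun S => S.IsSegment ∧ S.HasType (.edge, .edge)) = 19 ∧
    HandledGraph.isoClassCount (fun S => S.IsSegment ∧ S.HasType (.edge, .nonEdge)) = 78 ∧
    HandledGraph.isoClassCount (fun S => S.IsSegment ∧ S.HasType (.nonEdge, .edge)) = 78 ∧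
    HandledGraph.isoClassCount (fun S => S.IsSegment ∧ S.HasType (.nonEdge, .nonEdge)) = 303 := by
  obtain ⟨-, h₁, h₂, h₃, h₄⟩ := SegmentCount.canonicalList_spec
  refine ⟨?_, fun S => SegmentCount.existsUnique_hasType,
    (SegmentCount.isoClassCount_hasType false false).trans h₁,
    (SegmentCount.isoClassCount_hasType false true).trans h₂,
    (SegmentCount.isoClassCount_hasType true false).trans h₃,
    (SegmentCount.isoClassCount_hasType true true).trans h₄⟩
  rw [SegmentCount.isoClassCount_isSegment, SegmentCount.length_eq_sum_triangleCount, h₁, h₂, h₃, h₄]
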